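/- Let $G$ be a connected (finite-dimensional, smooth) Lie group with unit $e$ and Lie algebra $\mathfrak g=T_eG$, let $H$ be a closed subgroup with Lie algebra $\mathfrak h$, and let $G/H$ be the space of left cosets, with the smooth structure for which $\pi:G\to G/H$, $\pi(g)=gH$, is a smooth submersion. Write $o=eH$, $L_g$ for left translation by $g$ on $G$, and $\tau_g(g'H)=gg'H$. Assume that $G/H$ is reductive: $\mathfrak m\subset\mathfrak g$ is a subspace with $\mathfrak g=\mathfrak h\oplus\mathfrak m$ and $\mathrm{Ad}_a(\mathfrak m)\subset\mathfrak m$ for all $a\in H$. Let $p_{\mathfrak m}:\mathfrak g\to\mathfrak m$ be the projection along $\mathfrak h$. A Finsler function on a manifold $M$ is a non-negative continuous function $F:TM\to\mathbb R$ that is smooth on the slit tangent bundle, positively homogeneous ($F(\lambda v)=\lambda F(v)$ for $\lambda>0$), and strongly convex: for each $m$ the Hessian of the energy $E_m=\frac12(F|_{T_mM})^2$ is positive definite at every nonzero vector. Each restriction $F|_{T_mM}$ is then a Minkowski norm, i.e. a non-negative, positively homogeneous function, smooth off the origin, whose energy has positive definite Hessian off the origin. A surjective linear map $\mu:(V_1,\mathbf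 F_1)\to(V_2,\mathbf F_2)$ of vector spaces with Minkowski norms is a Minkowski submersion if it maps the closed unit ball of $\mathbf F_1$ onto that of $\mathbf F_2$. A smooth surjective map between Finsler manifolds is a Finsler submersion if all its tangent maps are Minkowski submersions; the Finsler function on the target is then called subduced. A homogeneous nonlinear lift for a linear surjection $\mu:V_1\to V_2$ is a continuous map $k:V_2\to V_1$, smooth on $V_2\setminus\{0\}$, with $\mu\circ k=\mathrm{id}$ and $k(\lambda v)=\lambda k(v)$ for $\lambda>0$; it is induced by $\mathbf F:V_1\to\mathbb R$ if $k(v)$ is, for each $v$, the unique minimizer of $\mathbf F$ on $\mu^{-1}(v)$. A homogeneous nonlinear splitting of $\pi:M\to N$ is a fibre-preserving map $h:\pi^*TN\to TM$, smooth on the slit pullback bundle, with $T\pi(h(m,v))=v$ and $h(m,\lambda v)=\lambda h(m,v)$ for $\lambda>0$; it is induced by a Finsler function $F$ on $M$ if $dE_m(h(m,v))(w)=0$ for all $(m,v)\in\pi^*TN$ and all $w\in\ker T_m\pi$. Let $F_1$ be a Finsler function on $G$ that is invariant under all left translations of $G$ and under right translations by elements of $H$. Then $\beta=T_e\pi|_{\mathfrak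 m}:\mathfrak m\to T_o(G/H)$ is a linear isomorphism, and: (i) there is a homogeneous nonlinear lift $\bar h:\mathfrak m\to\mathfrak g$ for $p_{\mathfrak m}$, induced by $F_1|_{T_eG}$, which is $\mathrm{Ad}(H)$-equivariant: $\bar h(\mathrm{Ad}_a\zeta)=\mathrm{Ad}_a\bar h(\zeta)$ for all $a\in H$, $\zeta\in\mathfrak m$; (ii) there is a Finsler function $F_2$ on $G/H$ that is $G$-invariant ($F_2\circ T\tau_g=F_2$ for all $g\in G$) and for which $\pi:(G,F_1)\to(G/H,F_2)$ is a Finsler submersion; it is the only Finsler function on $G/H$ for which $\pi$ is a Finsler submersion; (iii) there is exactly one splitting $h:\pi^*T(G/H)\to TG$ induced by $F_1$; it is a homogeneous nonlinear splitting, and for the lift $\bar h$ of (i) $$h(g,v)=T_eL_g\,\bar h\bigl(\beta^{-1}(T\tau_{g^{-1}}v)\bigr)\qquad\text{for all } g\in G,\ v\in T_{gH}(G/H).$$ -/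

import Mathlib

open scoped Manifold ContDiff
open Bundle

noncomputable section

/-! ### Minkowski submersions and nonlinear lifts -/

/-- The linear map `μ` is a submersion between `(V₁, F₁)` and `(V₂, F₂)`: it is surjective and maps
the closed unit ball (the closure of the open unit ball) of `F₁` onto that of `F₂`. -/
def IsMinkowskiSubmersion {V₁ V₂ : Type*}
    [AddCommGroup V₁] [Module ℝ V₁] [TopologicalSpace V₁]
    [AddCommGroup V₂] [Module ℝ V₂] [TopologicalSpace V₂]
    (μ : V₁ →ₗ[ℝ] V₂) (F₁ : V₁ → ℝ) (F₂ : V₂ → ℝ) : Prop :=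
  Function.Surjective μ ∧ μ '' closure {u | F₁ u < 1} = closure {v | F₂ v < 1}

/-- A homogeneous nonlinear lift for the linear map `μ : V₁ → V₂`: a continuous map `V₂ → V₁`,
smooth away from the origin, which is a section of `μ` and is positively homogeneous. -/
structure IsHomogeneousNonlinearLift {V₁ V₂ : Type*}
    [NormedAddCommGroup V₁] [NormedSpace ℝ V₁] [NormedAddCommGroup V₂] [NormedSpace ℝ V₂]
    (μ : V₁ →ₗ[ℝ] V₂) (k : V₂ → V₁) : Prop where
  continuous : Continuous k
  smooth : ContDiffOn ℝ ∞ k {0}ᶜ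
  section_eq : ∀ v, μ (k v) = v
  homogeneous : ∀ (c : ℝ) (v : V₂), 0 < c → k (c • v) = c • k v

/-- `k` is the lift induced by `F` along `μ`: `k v` is the unique vector over `v` at which `F`
attains its minimum on the fibre `μ ⁻¹ {v}`. -/
def IsLiftInducedBy {V₁ V₂ : Type*} [AddCommGroup V₁] [Module ℝ V₁] [AddCommGroup V₂] [Module ℝ V₂]
    (F : V₁ → ℝ) (μ : V₁ →ₗ[ℝ] V₂) (k : V₂ → V₁) : Prop :=
  ∀ v, μ (k v) = v ∧ ∀ u, μ u = v → u ≠ k v → F (k v) < F u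

/-! ### Finsler functions, Finsler submersions and nonlinear splittings -/

section Finsler

variable {E : Type*} [NormedAddCommGroup E] [NormedSpace ℝ E]
  {M : Type*} [TopologicalSpace M] [ChartedSpace E M]
  {E' : Type*} [NormedAddCommGroup E'] [NormedSpace ℝ E']
  {N : Type*} [TopologicalSpace N] [ChartedSpace E' N]

/-- The restriction of a function on the tangent bundle to the tangent space at `m`; the latter is
the model space `E`. -/
def fibreFunction (F : TangentBundle 𝓘(ℝ, E) M → ℝ) (m : M) : E → ℝ :=
  fun u => F (TotalSpace.mk' E m (show TangentSpace 𝓘(ℝ, E) m from u))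

/-- The energy of `F` restricted to the tangent space at `m`. -/
def fibreEnergy (F : TangentBundle 𝓘(ℝ, E) M → ℝ) (m : M) : E → ℝ :=
  fun u => fibreFunction F m u ^ 2 / 2

/-- A Finsler function: a non-negative continuous function on the tangent bundle, smooth on the
slit tangent bundle, positively homogeneous, and strongly convex on each tangent space. -/
structure IsFinslerFunction [IsManifold 𝓘(ℝ, E) ∞ M] (F : TangentBundle 𝓘(ℝ, E) M → ℝ) :
    Prop where
  nonneg : ∀ p, 0 ≤ F p
  continuous : Continuous F
  smooth : ContMDiffOn 𝓘(ℝ, E).tangent 𝓘(ℝ, ℝ) ∞ F {p | p.2 ≠ 0}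
  homogeneous : ∀ (c : ℝ) (m : M) (u : TangentSpace 𝓘(ℝ, E) m), 0 < c →
    F (TotalSpace.mk' E m (c • u)) = c * F (TotalSpace.mk' E m u)
  strongly_convex : ∀ (m : M) (u : E), u ≠ 0 → ∀ w : E, w ≠ 0 →
    0 < fderiv ℝ (fderiv ℝ (fibreEnergy F m)) u w w

/-- A surjective smooth map is a Finsler submersion if each of its tangent maps is a submersion of
Minkowski spaces. -/
def IsFinslerSubmersion (q : M → N) (F₁ : TangentBundle 𝓘(ℝ, E) M → ℝ)
    (F₂ : TangentBundle 𝓘(ℝ, E') N → ℝ) : Prop :=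
  ContMDiff 𝓘(ℝ, E) 𝓘(ℝ, E') ∞ q ∧ Function.Surjective q ∧
    ∀ m : M, IsMinkowskiSubmersion (mfderiv 𝓘(ℝ, E) 𝓘(ℝ, E') q m).toLinearMap
      (fun u => F₁ (TotalSpace.mk' E m u)) (fun v => F₂ (TotalSpace.mk' E' (q m) v))

/-- The map `q^*TN → TM`, `(m, v) ↦ (m, h m v)`, defined by a family of maps
`h m : T_{q m} N → T_m M`. Here `q^*TN` is the pullback of the tangent bundle of `N` by `q`. -/
def splittingMap (q : C(M, N))
    (h : ∀ m : M, TangentSpace 𝓘(ℝ, E') (q m) → TangentSpace 𝓘(ℝ, E) m) :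
    TotalSpace E' (q *ᵖ (TangentSpace 𝓘(ℝ, E') : N → Type _)) → TangentBundle 𝓘(ℝ, E) M :=
  fun p => TotalSpace.mk' E p.1 (h p.1 p.2)

/-- A homogeneous nonlinear splitting of `q : M → N`: a fibre-preserving map `h : q^*TN → TM` which
is smooth on the slit pullback bundle, is a section of the tangent map of `q`, and is positively
homogeneous. -/
structure IsHomogeneousNonlinearSplitting [IsManifold 𝓘(ℝ, E) ∞ M] [IsManifold 𝓘(ℝ, E') ∞ N]
    (q : C(M, N)) (h : ∀ m : M, TangentSpace 𝓘(ℝ, E') (q m) → TangentSpace 𝓘(ℝ, E) m) :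
    Prop where
  section_eq : ∀ (m : M) (v : TangentSpace 𝓘(ℝ, E') (q m)),
    mfderiv 𝓘(ℝ, E) 𝓘(ℝ, E') q m (h m v) = v
  smooth : ContMDiffOn (𝓘(ℝ, E).prod 𝓘(ℝ, E')) 𝓘(ℝ, E).tangent ∞ (splittingMap q h)
    {p | (show TangentSpace 𝓘(ℝ, E') (q p.1) from p.2) ≠ 0}
  homogeneous : ∀ (c : ℝ) (m : M) (v : TangentSpace 𝓘(ℝ, E') (q m)), 0 < c →
    h m (c • v) = c • h m v

/-- `h` is induced by the Finsler function `F`: it splits the tangent map of `q`, and along `h` the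
derivative of the energy of `F` in the direction of every vertical vector vanishes. -/
def IsSplittingInducedBy (F : TangentBundle 𝓘(ℝ, E) M → ℝ) (q : C(M, N))
    (h : ∀ m : M, TangentSpace 𝓘(ℝ, E') (q m) → TangentSpace 𝓘(ℝ, E) m) : Prop :=
  ∀ (m : M) (v : TangentSpace 𝓘(ℝ, E') (q m)),
    mfderiv 𝓘(ℝ, E) 𝓘(ℝ, E') q m (h m v) = v ∧
    ∀ w : TangentSpace 𝓘(ℝ, E) m, mfderiv 𝓘(ℝ, E) 𝓘(ℝ, E') q m w = 0 →
      fderiv ℝ (fibreEnergy F m) (show E from h m v) (show E from w) = 0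

end Finsler

/-! ### Lie groups and their homogeneous spaces

The Lie algebra `𝔤 = T_e G` of a Lie group `G` modelled on `E` is the vector space `E`. -/

section LieGroups

variable {E : Type*} [NormedAddCommGroup E] [NormedSpace ℝ E]
  {G : Type*} [TopologicalSpace G] [ChartedSpace E G] [Group G]

/-- The adjoint action of `a` on `𝔤 = T_e G`, the derivative at `e` of `x ↦ a x a⁻¹` (which fixes
`e`, so that source and target are both `T_e G`). -/
def adjointAction (E : Type*) [NormedAddCommGroup E] [NormedSpace ℝ E]
    {G : Type*} [TopologicalSpace G] [ChartedSpace E G] [Group G] (a : G) : E →L[ℝ] E :=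
  mfderiv 𝓘(ℝ, E) 𝓘(ℝ, E) (fun x : G => a * x * a⁻¹) 1

/-- `ξ ∈ T_e G` is the velocity at `0` of a smooth curve through `e` which lies in `H`. -/
def IsVelocityIn (H : Subgroup G) (ξ : E) : Prop :=
  ∃ γ : ℝ → G, ContMDiff 𝓘(ℝ, ℝ) 𝓘(ℝ, E) ∞ γ ∧ γ 0 = 1 ∧ (∀ t, γ t ∈ H) ∧
    (show E from mfderiv 𝓘(ℝ, ℝ) 𝓘(ℝ, E) γ 0 (1 : ℝ)) = ξ

theorem isVelocityIn_zero (H : Subgroup G) : IsVelocityIn H (0 : E) := by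
  refine ⟨fun _ => 1, contMDiff_const, rfl, fun _ => H.one_mem, ?_⟩
  rw [mfderiv_const]
  rfl

theorem isVelocityIn_smul (H : Subgroup G) (c : ℝ) {ξ : E} (hξ : IsVelocityIn H ξ) :
    IsVelocityIn H (c • ξ) := by
  obtain ⟨γ, hγ, h0, hH, rfl⟩ := hξ
  have hs : ContMDiff 𝓘(ℝ, ℝ) 𝓘(ℝ, ℝ) ∞ (fun t : ℝ => c * t) :=
    (contDiff_const.mul contDiff_id).contMDiff
  refine ⟨fun t => γ (c * t), hγ.comp hs, by simpa using h0, fun t => hH _, ?_⟩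
  have h1 : HasMFDerivAt 𝓘(ℝ, ℝ) 𝓘(ℝ, ℝ) (fun t : ℝ => c * t) 0
      (c • ContinuousLinearMap.id ℝ ℝ) :=
    ((hasFDerivAt_id (𝕜 := ℝ) (0 : ℝ)).const_mul c).hasMFDerivAt
  have h2 : HasMFDerivAt 𝓘(ℝ, ℝ) 𝓘(ℝ, E) γ (c * 0) (mfderiv 𝓘(ℝ, ℝ) 𝓘(ℝ, E) γ (c * 0)) :=
    ((hγ (c * 0)).mdifferentiableAt (by simp)).hasMFDerivAt
  have h3 := (HasMFDerivAt.comp (0 : ℝ) h2 h1).mfderiv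
  have h4 : mfderiv 𝓘(ℝ, ℝ) 𝓘(ℝ, E) (fun t => γ (c * t)) 0 = _ := h3
  rw [h4]
  refine (ContinuousLinearMap.map_smul
    (show ℝ →L[ℝ] E from mfderiv 𝓘(ℝ, ℝ) 𝓘(ℝ, E) γ (c * 0)) c (1 : ℝ)).trans ?_
  have h5 : ∀ s : ℝ, s = 0 → c • (show ℝ →L[ℝ] E from mfderiv 𝓘(ℝ, ℝ) 𝓘(ℝ, E) γ s) (1 : ℝ) =
      c • (show ℝ →L[ℝ] E from mfderiv 𝓘(ℝ, ℝ) 𝓘(ℝ, E) γ 0) (1 : ℝ) := by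
    rintro s rfl
    rfl
  exact h5 (c * 0) (mul_zero c)

theorem mfderiv_mul_one_one [LieGroup 𝓘(ℝ, E) ∞ G] {a b : G} (ha : a = 1) (hb : b = 1) (v w : E) :
    (show E × E →L[ℝ] E from mfderiv (𝓘(ℝ, E).prod 𝓘(ℝ, E)) 𝓘(ℝ, E)
      (fun p : G × G => p.1 * p.2) (a, b)) (v, w) = v + w := by
  subst ha hb
  have hmul : MDifferentiableAt (𝓘(ℝ, E).prod 𝓘(ℝ, E)) 𝓘(ℝ, E) (fun p : G × G => p.1 * p.2)
      (1, 1) := ((contMDiff_mul 𝓘(ℝ, E) ∞) ((1 : G), (1 : G))).mdifferentiableAt (by simp)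
  have h5 := mfderiv_prod_eq_add_apply (p := ((1 : G), (1 : G)))
    (v := (show TangentSpace (𝓘(ℝ, E).prod 𝓘(ℝ, E)) ((1 : G), (1 : G)) from (v, w))) hmul
  have e1 : (fun z : G => z * 1) = id := funext mul_one
  have e2 : (fun z : G => 1 * z) = id := funext one_mul
  refine h5.trans ?_
  dsimp only
  rw [e1, e2, mfderiv_id]
  rfl

theorem isVelocityIn_add [LieGroup 𝓘(ℝ, E) ∞ G] (H : Subgroup G) {ξ η : E}
    (hξ : IsVelocityIn H ξ) (hη : IsVelocityIn H η) : IsVelocityIn H (ξ + η) := by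
  obtain ⟨γ, hγ, h0, hH, rfl⟩ := hξ
  obtain ⟨δ, hδ, k0, kH, rfl⟩ := hη
  refine ⟨fun t => γ t * δ t, hγ.mul hδ, by simp [h0, k0], fun t => H.mul_mem (hH t) (kH t), ?_⟩
  have hγ' := ((hγ 0).mdifferentiableAt (by simp)).hasMFDerivAt
  have hδ' := ((hδ 0).mdifferentiableAt (by simp)).hasMFDerivAt
  have hmul : MDifferentiableAt (𝓘(ℝ, E).prod 𝓘(ℝ, E)) 𝓘(ℝ, E) (fun p : G × G => p.1 * p.2)
      (γ 0, δ 0) := ((contMDiff_mul 𝓘(ℝ, E) ∞) (γ 0, δ 0)).mdifferentiableAt (by simp)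
  have h3 := (HasMFDerivAt.comp (0 : ℝ) hmul.hasMFDerivAt (hγ'.prodMk hδ')).mfderiv
  have h4 : mfderiv 𝓘(ℝ, ℝ) 𝓘(ℝ, E) (fun t => γ t * δ t) 0 = _ := h3
  rw [h4]
  exact mfderiv_mul_one_one h0 k0 _ _

/-- The Lie algebra `𝔥 ⊆ 𝔤` of a closed subgroup `H` of a Lie group `G`: the space of velocities at
`e` of smooth curves in `G` that lie in `H`. -/
def subgroupLieAlgebra (E : Type*) [NormedAddCommGroup E] [NormedSpace ℝ E]
    {G : Type*} [TopologicalSpace G] [ChartedSpace E G] [Group G] [LieGroup 𝓘(ℝ, E) ∞ G]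
    (H : Subgroup G) : Submodule ℝ E where
  carrier := {ξ | IsVelocityIn H ξ}
  zero_mem' := isVelocityIn_zero H
  add_mem' := isVelocityIn_add H
  smul_mem' := fun c _ h => isVelocityIn_smul H c h

/-- `𝔪` is a reductive complement: `𝔤 = 𝔥 ⊕ 𝔪` and `𝔪` is invariant under `Ad(H)`. -/
structure IsReductiveComplement [LieGroup 𝓘(ℝ, E) ∞ G] (H : Subgroup G) (𝔪 : Submodule ℝ E) :
    Prop where
  isCompl : IsCompl 𝔪 (subgroupLieAlgebra E H)
  adjoint_mem : ∀ a ∈ H, ∀ ζ ∈ 𝔪, adjointAction E a ζ ∈ 𝔪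

/-- `F` is invariant under all left translations of `G`. -/
def IsLeftInvariant (F : TangentBundle 𝓘(ℝ, E) G → ℝ) : Prop :=
  ∀ (g : G) (p : TangentBundle 𝓘(ℝ, E) G),
    F (tangentMap 𝓘(ℝ, E) 𝓘(ℝ, E) (fun x : G => g * x) p) = F p

/-- `F` is invariant under the right translations by elements of `H`. -/
def IsRightInvariantUnder (H : Subgroup G) (F : TangentBundle 𝓘(ℝ, E) G → ℝ) : Prop :=
  ∀ a ∈ H, ∀ p : TangentBundle 𝓘(ℝ, E) G,
    F (tangentMap 𝓘(ℝ, E) 𝓘(ℝ, E) (fun x : G => x * a) p) = F p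

/-- `F` on `T(G/H)` is invariant under the natural action `τ_g (xH) = gxH` of `G`. -/
def IsGInvariant {E' : Type*} [NormedAddCommGroup E'] [NormedSpace ℝ E'] {H : Subgroup G}
    [ChartedSpace E' (G ⧸ H)] (F : TangentBundle 𝓘(ℝ, E') (G ⧸ H) → ℝ) : Prop :=
  ∀ (g : G) (p : TangentBundle 𝓘(ℝ, E') (G ⧸ H)),
    F (tangentMap 𝓘(ℝ, E') 𝓘(ℝ, E') (fun x : G ⧸ H => g • x) p) = F p

/-- The projection `G → G/H`, `g ↦ gH`, as a continuous map. -/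
def cosetProj (H : Subgroup G) : C(G, G ⧸ H) :=
  ⟨fun g => (g : G ⧸ H), continuous_quot_mk⟩

end LieGroups

end

/-!
The energy `E` of a Minkowski norm `f` on a finite-dimensional space is strictly convex along every
line: along lines avoiding the origin because its Hessian is positive definite, along lines through
the origin because it is homogeneous of degree two. Hence, for a linear surjection `μ`, a point of a
fibre of `μ` minimizes `f` on the fibre if and only if `dE` vanishes on `ker μ` there, and there is
exactly one such point, `k v`, on the fibre over `v`. A family of such points is called a critical
lift (`IsCriticalLift`). It is the lift induced by `f`; it is smooth away from the origin by the
inverse function theorem applied to `u ↦ (μ u, dE u |_ker μ)` (`IsCriticalLift.contDiffAt`); and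
`f ∘ k` is a Minkowski norm for which `μ` is a Minkowski submersion
(`IsCriticalLift.isMinkowskiNorm_comp`, `IsCriticalLift.isMinkowskiSubmersion`). Being characterized
by minimality, critical lifts are natural under linear isomorphisms (`IsCriticalLift.map_apply`).

Let `π : G → G/H` be the projection and let `h g` be the critical lift for the norm `F₁` on `T_g G`
and the surjection `T_g π`. This family is the only splitting induced by `F₁`. Naturality turns the
invariance of `F₁` into `h (a g) ∘ T τ_a = T L_a ∘ h g` for `a ∈ G` and `h (g a) = T R_a ∘ h g` for
`a ∈ H` (`criticalLift_mul_left`, `criticalLift_mul_right`). From these two relations follow the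
formula for `h`, its smoothness, the `Ad(H)`-equivariance of `h e`, and the fact that
`F₂ (gH, v) = F₁ (g, h g v)` is well defined and `G`-invariant. The smoothness of `F₂` is reduced by
local sections of `π` to that of `F₁ ∘ h e` on `T_o(G/H)`. A Minkowski norm is determined by its
closed unit ball, so `F₂` is the only Finsler function for which `π` is a Finsler submersion.

Finally, `𝔥` is the kernel of `T_e π` (`mem_subgroupLieAlgebra_iff`): every vertical vector of a
submersion is the velocity of a curve in the fibre (`exists_curve_in_fibre`). Therefore `T_e π`
restricts to an isomorphism `β : 𝔪 → T_o(G/H)` which carries the projection of `𝔤` onto `𝔪` to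
`T_e π`, and `h e ∘ β` is the critical lift for that projection.
-/

noncomputable section

open Filter Topology

/-! ### Minkowski norms -/

section Minkowski

variable {V W : Type*} [NormedAddCommGroup V] [NormedSpace ℝ V] [NormedAddCommGroup W]
  [NormedSpace ℝ W]

theorem hasFDerivAt_clm_apply_const {g : W → V →L[ℝ] ℝ} {g' : W →L[ℝ] V →L[ℝ] ℝ} {x : W}
    (h : HasFDerivAt g g' x) (y : V) : HasFDerivAt (fun x => g x y) (g'.flip y) x :=
  (ContinuousLinearMap.apply ℝ ℝ y).hasFDerivAt.comp x h

/-- A map between spaces of the same finite dimension which is smooth at `u`, with injective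
derivative there, has a smooth right inverse near the image of `u`. -/
theorem exists_contDiffAt_rightInverse [FiniteDimensional ℝ V] [FiniteDimensional ℝ W] {Φ : V → W}
    {u : V} (hΦ : ContDiffAt ℝ ∞ Φ u) (hinj : Function.Injective (fderiv ℝ Φ u))
    (hdim : Module.finrank ℝ V = Module.finrank ℝ W) :
    ∃ ψ : W → V, ContDiffAt ℝ ∞ ψ (Φ u) ∧ ∀ᶠ x in 𝓝 (Φ u), Φ (ψ x) = x := by
  have hn : (∞ : WithTop ℕ∞) ≠ 0 := by simp
  let e : V ≃L[ℝ] W :=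
    (LinearEquiv.ofInjectiveOfFinrankEq (fderiv ℝ Φ u : V →ₗ[ℝ] W) hinj
      hdim).toContinuousLinearEquiv
  have he : HasFDerivAt Φ (e : V →L[ℝ] W) u := by
    convert! (hΦ.differentiableAt hn).hasFDerivAt using 1
  exact ⟨hΦ.localInverse he hn, hΦ.to_localInverse he hn,
    (hΦ.hasStrictFDerivAt' he hn).eventually_right_inverse⟩

/-- Smoothness and derivative of `u ↦ (μ u, g u ∘ ι)`, where `g` takes values in the dual space. -/
theorem contDiffAt_prod_comp_and_fderiv_apply {K : Type*} [NormedAddCommGroup K] [NormedSpace ℝ K]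
    {g : V → V →L[ℝ] ℝ} {u : V} (hg : ContDiffAt ℝ ∞ g u) (μ : V →L[ℝ] W) (ι : K →L[ℝ] V) :
    ContDiffAt ℝ ∞ (fun u => (μ u, (g u).comp ι)) u ∧
      ∀ w, fderiv ℝ (fun u => (μ u, (g u).comp ι)) u w = (μ w, (fderiv ℝ g u w).comp ι) := by
  have h1 : ContDiffAt ℝ ∞ (fun u => (g u).comp ι) u := hg.clm_comp contDiffAt_const
  have h2 : HasFDerivAt (fun u => (g u).comp ι) (fderiv ℝ (fun u => (g u).comp ι) u) u :=
    (h1.differentiableAt (by simp)).hasFDerivAt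
  refine ⟨μ.contDiff.contDiffAt.prodMk h1, fun w => ?_⟩
  rw [(μ.hasFDerivAt.prodMk h2).fderiv]
  refine Prod.ext rfl (ContinuousLinearMap.ext fun y => ?_)
  have h3 := hasFDerivAt_clm_apply_const (hg.differentiableAt (by simp)).hasFDerivAt (ι y)
  exact DFunLike.congr_fun ((hasFDerivAt_clm_apply_const h2 y).unique h3) w

/-- The energy `f ^ 2 / 2` of a function on a vector space. -/
def energy (f : V → ℝ) : V → ℝ := fun u => f u ^ 2 / 2

/-- A Minkowski norm: non-negative, continuous, smooth away from the origin and positively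
homogeneous, with positive definite Hessian of the energy away from the origin. -/
structure IsMinkowskiNorm (f : V → ℝ) : Prop where
  nonneg : ∀ u, 0 ≤ f u
  continuous : Continuous f
  smooth : ContDiffOn ℝ ∞ f {0}ᶜ
  homogeneous : ∀ (c : ℝ) (u : V), 0 < c → f (c • u) = c * f u
  strongly_convex : ∀ u : V, u ≠ 0 → ∀ w : V, w ≠ 0 → 0 < fderiv ℝ (fderiv ℝ (energy f)) u w w

/-- `k` picks in each fibre of `μ` a point at which the derivative of the energy of `f` vanishes
along the fibre. -/
def IsCriticalLift (f : V → ℝ) (μ : V →ₗ[ℝ] W) (k : W → V) : Prop :=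
  ∀ v, μ (k v) = v ∧ ∀ w, μ w = 0 → fderiv ℝ (energy f) (k v) w = 0

namespace IsMinkowskiNorm

variable {f : V → ℝ}

theorem map_zero (hf : IsMinkowskiNorm f) : f 0 = 0 := by
  have h := hf.homogeneous 2 0 two_pos
  rw [smul_zero] at h
  linarith

theorem contDiffAt (hf : IsMinkowskiNorm f) {u : V} (hu : u ≠ 0) : ContDiffAt ℝ ∞ f u :=
  hf.smooth.contDiffAt (isOpen_compl_singleton.mem_nhds hu)

theorem contDiffAt_energy (hf : IsMinkowskiNorm f) {u : V} (hu : u ≠ 0) :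
    ContDiffAt ℝ ∞ (energy f) u :=
  ((hf.contDiffAt hu).pow 2).div_const 2

theorem contDiffAt_fderiv_energy (hf : IsMinkowskiNorm f) {u : V} (hu : u ≠ 0) :
    ContDiffAt ℝ ∞ (fderiv ℝ (energy f)) u :=
  (hf.contDiffAt_energy hu).fderiv_right (m := ∞) (by simp)

theorem hasFDerivAt_energy (hf : IsMinkowskiNorm f) {u : V} (hu : u ≠ 0) :
    HasFDerivAt (energy f) (fderiv ℝ (energy f) u) u :=
  ((hf.contDiffAt_energy hu).differentiableAt (by simp)).hasFDerivAt

theorem hasFDerivAt_fderiv_energy (hf : IsMinkowskiNorm f) {u : V} (hu : u ≠ 0) :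
    HasFDerivAt (fderiv ℝ (energy f)) (fderiv ℝ (fderiv ℝ (energy f)) u) u :=
  ((hf.contDiffAt_fderiv_energy hu).differentiableAt (by simp)).hasFDerivAt

theorem energy_smul (hf : IsMinkowskiNorm f) {c : ℝ} (hc : 0 < c) (u : V) :
    energy f (c • u) = c ^ 2 * energy f u := by
  simp only [energy, hf.homogeneous c u hc]
  ring

theorem hasDerivAt_line (u w : V) (t : ℝ) : HasDerivAt (fun t : ℝ => u + t • w) w t := by
  simpa using ((hasDerivAt_id t).smul_const w).const_add u

theorem hasDerivAt_energy_line (hf : IsMinkowskiNorm f) {u w : V} {t : ℝ} (h : u + t • w ≠ 0) :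
    HasDerivAt (fun t : ℝ => energy f (u + t • w)) (fderiv ℝ (energy f) (u + t • w) w) t :=
  HasFDerivAt.comp_hasDerivAt (f := fun t : ℝ => u + t • w) t (hf.hasFDerivAt_energy h)
    (hasDerivAt_line u w t)

theorem hasDerivAt_fderiv_energy_line (hf : IsMinkowskiNorm f) {u w : V} {t : ℝ}
    (h : u + t • w ≠ 0) :
    HasDerivAt (fun t : ℝ => fderiv ℝ (energy f) (u + t • w) w)
      (fderiv ℝ (fderiv ℝ (energy f)) (u + t • w) w w) t := by
  have h1 := (hf.hasFDerivAt_fderiv_energy h).comp_hasDerivAt t (hasDerivAt_line u w t)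
  simpa using h1.clm_apply (hasDerivAt_const t w)

/-- Euler's relation for the energy, which is positively homogeneous of degree two. -/
theorem fderiv_energy_smul_self (hf : IsMinkowskiNorm f) {u : V} (hu : u ≠ 0) {t : ℝ}
    (ht : 0 < t) : fderiv ℝ (energy f) (t • u) u = 2 * t * energy f u := by
  have h0 : (0 : V) + t • u ≠ 0 := by simpa using ⟨ht.ne', hu⟩
  have h1 := hf.hasDerivAt_energy_line h0
  have h2 : HasDerivAt (fun s : ℝ => s ^ 2 * energy f u) (2 * t * energy f u) t := by
    simpa using (hasDerivAt_pow 2 t).mul_const (energy f u)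
  have h3 : (fun s : ℝ => energy f ((0 : V) + s • u)) =ᶠ[𝓝 t] fun s => s ^ 2 * energy f u := by
    filter_upwards [lt_mem_nhds ht] with s hs
    rw [zero_add, hf.energy_smul hs]
  simpa using (h1.congr_of_eventuallyEq h3.symm).unique h2

theorem fderiv_energy_self (hf : IsMinkowskiNorm f) {u : V} (hu : u ≠ 0) :
    fderiv ℝ (energy f) u u = 2 * energy f u := by
  simpa using hf.fderiv_energy_smul_self hu one_pos

theorem energy_pos (hf : IsMinkowskiNorm f) {u : V} (hu : u ≠ 0) : 0 < energy f u := by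
  have h0 : (0 : V) + (1 : ℝ) • u ≠ 0 := by simpa using hu
  have h1 := hf.hasDerivAt_fderiv_energy_line h0
  have h2 : HasDerivAt (fun s : ℝ => 2 * s * energy f u) (2 * energy f u) 1 := by
    simpa using ((hasDerivAt_id (1 : ℝ)).const_mul 2).mul_const (energy f u)
  have h3 : (fun s : ℝ => fderiv ℝ (energy f) ((0 : V) + s • u) u) =ᶠ[𝓝 1]
      fun s => 2 * s * energy f u := by
    filter_upwards [lt_mem_nhds one_pos] with s hs
    rw [zero_add, hf.fderiv_energy_smul_self hu hs]
  have h4 := (h1.congr_of_eventuallyEq h3.symm).unique h2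
  have h5 := hf.strongly_convex u hu u hu
  rw [zero_add, one_smul] at h4
  linarith

theorem pos (hf : IsMinkowskiNorm f) {u : V} (hu : u ≠ 0) : 0 < f u := by
  refine (hf.nonneg u).lt_of_ne' fun h => ?_
  have := hf.energy_pos hu
  simp [energy, h] at this

theorem lt_of_energy_lt (hf : IsMinkowskiNorm f) {u v : V} (h : energy f u < energy f v) :
    f u < f v := by
  refine lt_of_pow_lt_pow_left₀ 2 (hf.nonneg v) ?_
  simp only [energy] at h
  linarith

/-- The energy is strictly convex along lines, so a critical point of its restriction to a line is
a strict minimum. -/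
theorem lt_of_fderiv_energy_eq_zero (hf : IsMinkowskiNorm f) {u w : V} (hw : w ≠ 0)
    (h : fderiv ℝ (energy f) u w = 0) : f u < f (u + w) := by
  rcases eq_or_ne u 0 with rfl | hu
  · rw [hf.map_zero, zero_add]
    exact hf.pos hw
  -- The line avoids the origin: otherwise `u` is a multiple of `w`, against Euler's relation.
  have hne : ∀ t : ℝ, u + t • w ≠ 0 := by
    intro t ht
    have h1 := hf.fderiv_energy_self hu
    have h2 : u = (-t) • w := by rw [neg_smul]; exact eq_neg_of_add_eq_zero_left ht
    have h3 : fderiv ℝ (energy f) u u = (-t) * fderiv ℝ (energy f) u w := by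
      conv_lhs => rw [h2, map_smul, smul_eq_mul]
      rw [← h2]
    rw [h3, h, mul_zero] at h1
    linarith [hf.energy_pos hu]
  have hmono : StrictMono fun t : ℝ => fderiv ℝ (energy f) (u + t • w) w := by
    refine strictMono_of_deriv_pos fun t => ?_
    rw [(hf.hasDerivAt_fderiv_energy_line (hne t)).deriv]
    exact hf.strongly_convex _ (hne t) w hw
  have hφ : StrictMonoOn (fun t : ℝ => energy f (u + t • w)) (Set.Ici 0) := by
    refine strictMonoOn_of_deriv_pos (convex_Ici 0)
      (fun t _ => (hf.hasDerivAt_energy_line (hne t)).continuousAt.continuousWithinAt)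
      fun t ht => ?_
    rw [interior_Ici] at ht
    rw [(hf.hasDerivAt_energy_line (hne t)).deriv]
    have := hmono (show (0 : ℝ) < t from ht)
    simpa [h] using this
  have := hφ (Set.mem_Ici.2 le_rfl) (Set.mem_Ici.2 zero_le_one) one_pos
  refine hf.lt_of_energy_lt ?_
  simpa using this

theorem closure_lt_one (hf : IsMinkowskiNorm f) : closure {u | f u < 1} = {u | f u ≤ 1} := by
  refine Set.Subset.antisymm
    (closure_minimal (fun u hu => show f u ≤ 1 from le_of_lt hu)
      (isClosed_le hf.continuous continuous_const)) ?_
  intro u hu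
  have h1 : Tendsto (fun t : ℝ => t • u) (𝓝[<] 1) (𝓝 u) := by
    have : ContinuousAt (fun t : ℝ => t • u) 1 := by fun_prop
    simpa using this.tendsto.mono_left nhdsWithin_le_nhds
  refine mem_closure_of_tendsto h1 ?_
  filter_upwards [self_mem_nhdsWithin, nhdsWithin_le_nhds (lt_mem_nhds one_pos)] with t ht1 ht0
  rw [hf.homogeneous t u ht0]
  exact (mul_le_of_le_one_right ht0.le hu).trans_lt ht1

variable [FiniteDimensional ℝ V]

theorem exists_upper_bound (hf : IsMinkowskiNorm f) : ∃ C : ℝ, 0 ≤ C ∧ ∀ u, f u ≤ C * ‖u‖ := by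
  obtain ⟨C, hC⟩ := (isCompact_sphere (0 : V) 1).bddAbove_image hf.continuous.continuousOn
  refine ⟨max C 0, le_max_right _ _, fun u => ?_⟩
  rcases eq_or_ne u 0 with rfl | hu
  · simp [hf.map_zero]
  have hn := norm_pos_iff.2 hu
  have h1 : f (‖u‖⁻¹ • u) ≤ C :=
    hC ⟨_, by simp [norm_smul, hn.ne'], rfl⟩
  rw [hf.homogeneous _ _ (inv_pos.2 hn), inv_mul_le_iff₀ hn, mul_comm] at h1
  exact h1.trans (mul_le_mul_of_nonneg_right (le_max_left _ _) hn.le)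

theorem exists_lower_bound (hf : IsMinkowskiNorm f) : ∃ c : ℝ, 0 < c ∧ ∀ u, c * ‖u‖ ≤ f u := by
  rcases subsingleton_or_nontrivial V with hV | hV
  · exact ⟨1, one_pos, fun u => by simp [Subsingleton.elim u 0, hf.map_zero]⟩
  obtain ⟨u₀, hu₀, hmin⟩ := (isCompact_sphere (0 : V) 1).exists_isMinOn
    (NormedSpace.sphere_nonempty.2 zero_le_one) hf.continuous.continuousOn
  have h0 : u₀ ≠ 0 := by rintro rfl; simp at hu₀
  refine ⟨f u₀, hf.pos h0, fun u => ?_⟩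
  rcases eq_or_ne u 0 with rfl | hu
  · simp [hf.map_zero]
  have hn := norm_pos_iff.2 hu
  have h1 : f u₀ ≤ f (‖u‖⁻¹ • u) := hmin (show _ ∈ Metric.sphere (0 : V) 1 by
    simp [norm_smul, hn.ne'])
  rw [hf.homogeneous _ _ (inv_pos.2 hn), le_inv_mul_iff₀ hn, mul_comm] at h1
  exact h1

/-- The energy is differentiable at the origin as well, being bounded by a multiple of the squared
norm. -/
theorem hasFDerivAt_energy_zero (hf : IsMinkowskiNorm f) :
    HasFDerivAt (energy f) (0 : V →L[ℝ] ℝ) 0 := by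
  obtain ⟨C, hC, hb⟩ := hf.exists_upper_bound
  rw [hasFDerivAt_iff_isLittleO_nhds_zero]
  have h1 : (fun u : V => energy f (0 + u) - energy f 0 - (0 : V →L[ℝ] ℝ) u) =O[𝓝 0]
      fun u => ‖u‖ ^ 2 := by
    refine Asymptotics.IsBigO.of_bound (C ^ 2 / 2) (Eventually.of_forall fun u => ?_)
    have h2 : f u ^ 2 ≤ (C * ‖u‖) ^ 2 := pow_le_pow_left₀ (hf.nonneg u) (hb u) 2
    have h3 : 0 ≤ f u ^ 2 := sq_nonneg _
    simp only [energy, zero_add, hf.map_zero, zero_apply, sub_zero, ne_eq, OfNat.ofNat_ne_zero,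
      not_false_eq_true, zero_pow, zero_div,
      Real.norm_eq_abs]
    rw [abs_of_nonneg (by positivity), abs_of_nonneg (by positivity)]
    nlinarith
  refine h1.trans_isLittleO ?_
  have := Asymptotics.isLittleO_norm_pow_id (E' := V) (n := 2) one_lt_two
  simpa using this

theorem differentiable_energy (hf : IsMinkowskiNorm f) : Differentiable ℝ (energy f) := by
  intro u
  rcases eq_or_ne u 0 with rfl | hu
  · exact hf.hasFDerivAt_energy_zero.differentiableAt
  · exact (hf.hasFDerivAt_energy hu).differentiableAt

end IsMinkowskiNorm

/-- A nonnegative positively homogeneous function is determined by its closed unit ball. -/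
theorem eq_of_setOf_le_one_eq {f₁ f₂ : V → ℝ} (h₁ : ∀ u, 0 ≤ f₁ u) (h₂ : ∀ u, 0 ≤ f₂ u)
    (hom₁ : ∀ (c : ℝ) (u : V), 0 < c → f₁ (c • u) = c * f₁ u)
    (hom₂ : ∀ (c : ℝ) (u : V), 0 < c → f₂ (c • u) = c * f₂ u)
    (h : {u | f₁ u ≤ 1} = {u | f₂ u ≤ 1}) : f₁ = f₂ := by
  have key : ∀ {g₁ g₂ : V → ℝ}, (∀ u, 0 ≤ g₂ u) →
      (∀ (c : ℝ) (u : V), 0 < c → g₁ (c • u) = c * g₁ u) →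
      (∀ (c : ℝ) (u : V), 0 < c → g₂ (c • u) = c * g₂ u) →
      {u | g₂ u ≤ 1} ⊆ {u | g₁ u ≤ 1} → ∀ u, g₁ u ≤ g₂ u := by
    intro g₁ g₂ n₂ m₁ m₂ hs u
    refine le_of_forall_gt_imp_ge_of_dense fun c hc => ?_
    have hc0 := (n₂ u).trans_lt hc
    have h3 : c⁻¹ • u ∈ {u | g₂ u ≤ 1} := by
      rw [Set.mem_ofPred_eq, m₂ _ _ (inv_pos.2 hc0), inv_mul_le_iff₀ hc0, mul_one]
      exact hc.le
    have h4 := hs h3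
    rwa [Set.mem_ofPred_eq, m₁ _ _ (inv_pos.2 hc0), inv_mul_le_iff₀ hc0, mul_one] at h4
  exact funext fun u => le_antisymm (key h₂ hom₁ hom₂ h.symm.subset u) (key h₁ hom₂ hom₁ h.subset u)

/-! ### Critical lifts along a linear surjection -/

/-- On each fibre of a linear surjection a Minkowski norm attains its minimum, which is a critical
point of the energy along the fibre. -/
theorem IsMinkowskiNorm.exists_isCriticalLift [FiniteDimensional ℝ V] {f : V → ℝ}
    (hf : IsMinkowskiNorm f) {μ : V →ₗ[ℝ] W} (hμ : Function.Surjective μ) : ∃ k, IsCriticalLift f μ k := by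
  refine Classical.axiom_of_choice (r := fun v u => μ u = v ∧ ∀ w, μ w = 0 →
    fderiv ℝ (energy f) u w = 0) fun v => ?_
  obtain ⟨u₀, hu₀⟩ := hμ v
  obtain ⟨c, hc, hcf⟩ := hf.exists_lower_bound
  have hclosed : IsClosed (μ ⁻¹' {v}) :=
    isClosed_singleton.preimage μ.continuous_of_finiteDimensional
  have hcoer : Tendsto f (cocompact V) atTop :=
    tendsto_atTop_mono hcf (tendsto_norm_cocompact_atTop.const_mul_atTop hc)
  obtain ⟨u, hu, hmin⟩ := hf.continuous.continuousOn.exists_isMinOn' hclosed hu₀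
    ((hcoer.eventually_ge_atTop (f u₀)).filter_mono inf_le_left)
  refine ⟨u, hu, fun w hw => ?_⟩
  have h1 : HasDerivAt (fun t : ℝ => energy f (u + t • w)) (fderiv ℝ (energy f) u w) 0 := by
    have h2 : HasFDerivAt (energy f) (fderiv ℝ (energy f) u) (u + (0 : ℝ) • w) := by
      simpa using (hf.differentiable_energy u).hasFDerivAt
    exact h2.comp_hasDerivAt (0 : ℝ) (IsMinkowskiNorm.hasDerivAt_line u w 0)
  refine IsLocalMin.hasDerivAt_eq_zero (Eventually.of_forall fun t => ?_) h1
  have h3 : f u ≤ f (u + t • w) := hmin (show u + t • w ∈ μ ⁻¹' {v} by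
    have : μ u = v := hu
    simp [this, hw])
  have := pow_le_pow_left₀ (hf.nonneg u) h3 2
  simp only [energy, zero_smul, add_zero]
  linarith

namespace IsCriticalLift

variable {f : V → ℝ} {μ : V →ₗ[ℝ] W} {k : W → V}

/-- A vector over `v` which is critical along its fibre is `k v`. -/
theorem eq_of_critical (hf : IsMinkowskiNorm f) (hk : IsCriticalLift f μ k) {u : V}
    (hu : ∀ w, μ w = 0 → fderiv ℝ (energy f) u w = 0) : u = k (μ u) := by
  by_contra hne
  have h1 : μ (k (μ u) - u) = 0 := by rw [map_sub, (hk _).1, sub_self]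
  have h2 : μ (u - k (μ u)) = 0 := by rw [map_sub, (hk _).1, sub_self]
  have l1 := hf.lt_of_fderiv_energy_eq_zero (sub_ne_zero.2 (Ne.symm hne)) (hu _ h1)
  have l2 := hf.lt_of_fderiv_energy_eq_zero (sub_ne_zero.2 hne) ((hk (μ u)).2 _ h2)
  rw [add_sub_cancel] at l1 l2
  exact lt_asymm l1 l2

theorem unique (hf : IsMinkowskiNorm f) (hk : IsCriticalLift f μ k) {k' : W → V}
    (hk' : IsCriticalLift f μ k') : k' = k :=
  funext fun v => by simpa [(hk' v).1] using eq_of_critical hf hk (hk' v).2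

theorem isLiftInducedBy (hf : IsMinkowskiNorm f) (hk : IsCriticalLift f μ k) :
    IsLiftInducedBy f μ k := by
  refine fun v => ⟨(hk v).1, fun u hu hne => ?_⟩
  have h2 : μ (u - k v) = 0 := by rw [map_sub, (hk _).1, hu, sub_self]
  have l2 := hf.lt_of_fderiv_energy_eq_zero (sub_ne_zero.2 hne) ((hk v).2 _ h2)
  rwa [add_sub_cancel] at l2

theorem apply_le (hf : IsMinkowskiNorm f) (hk : IsCriticalLift f μ k) (u : V) :
    f (k (μ u)) ≤ f u := by
  rcases eq_or_ne u (k (μ u)) with h | h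
  · rw [← h]
  · exact ((isLiftInducedBy hf hk (μ u)).2 u rfl h).le

theorem apply_ne_zero (hk : IsCriticalLift f μ k) {v : W} (hv : v ≠ 0) : k v ≠ 0 := by
  intro h
  have := (hk v).1
  rw [h, _root_.map_zero] at this
  exact hv this.symm

/-- Naturality: a surjective map of total spaces which preserves the norms and covers an injective
map of the bases intertwines the lifts, by uniqueness of the minimizers. -/
theorem map_apply {V' W' : Type*} [NormedAddCommGroup V'] [NormedSpace ℝ V']
    [NormedAddCommGroup W'] [NormedSpace ℝ W'] {f' : V' → ℝ} {μ' : V' →ₗ[ℝ] W'} {k' : W' → V'}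
    (hf : IsMinkowskiNorm f) (hk : IsCriticalLift f μ k)
    (hf' : IsMinkowskiNorm f') (hk' : IsCriticalLift f' μ' k')
    {A : V → V'} {B : W → W'} (hA : Function.Surjective A) (hB : Function.Injective B)
    (hfA : ∀ u, f' (A u) = f u) (hAB : ∀ u, μ' (A u) = B (μ u)) (v : W) :
    k' (B v) = A (k v) := by
  by_contra hne
  obtain ⟨u, hu⟩ := hA (k' (B v))
  have h1 := (isLiftInducedBy hf' hk' (B v)).2 (A (k v)) (by rw [hAB, (hk v).1]) (Ne.symm hne)
  have h2 : μ u = v := hB (by rw [← hAB, hu, (hk' _).1])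
  have h3 := apply_le hf hk u
  rw [h2, ← hfA, ← hfA u, hu] at h3
  exact absurd h1 (not_lt.2 h3)

theorem homogeneous (hf : IsMinkowskiNorm f) (hk : IsCriticalLift f μ k) (c : ℝ) (v : W)
    (hc : 0 < c) : k (c • v) = c • k v := by
  by_contra hne
  have h1 := (isLiftInducedBy hf hk (c • v)).2 (c • k v) (by rw [map_smul, (hk v).1]) (Ne.symm hne)
  have h2 := apply_le hf hk (c⁻¹ • k (c • v))
  rw [map_smul, (hk _).1, inv_smul_smul₀ hc.ne', hf.homogeneous _ _ (inv_pos.2 hc),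
    le_inv_mul_iff₀ hc] at h2
  rw [hf.homogeneous _ _ hc] at h1
  exact absurd h1 (not_lt.2 h2)

theorem map_zero (hf : IsMinkowskiNorm f) (hk : IsCriticalLift f μ k) : k 0 = 0 := by
  have h := homogeneous hf hk 2 0 two_pos
  rw [smul_zero, two_smul] at h
  exact left_eq_add.1 h

variable [FiniteDimensional ℝ V] [FiniteDimensional ℝ W]

/-- Smoothness of the lift, by the inverse function theorem for `u ↦ (μ u, dE u |_ker μ)`, whose
derivative is injective because the Hessian is positive definite on `ker μ`. -/
theorem contDiffAt (hf : IsMinkowskiNorm f) (hk : IsCriticalLift f μ k)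
    {v : W} (hv : v ≠ 0) : ContDiffAt ℝ ∞ k v := by
  have hu := apply_ne_zero hk hv
  have hμ : Function.Surjective μ := fun v => ⟨k v, (hk v).1⟩
  let μc : V →L[ℝ] W := LinearMap.toContinuousLinearMap μ
  obtain ⟨ι, hι⟩ : ∃ ι : LinearMap.ker μ →L[ℝ] V, ∀ w, ι w = w :=
    ⟨(LinearMap.ker μ).subtypeL, fun _ => rfl⟩
  let Φ : V → W × (LinearMap.ker μ →L[ℝ] ℝ) := fun u => (μc u, (fderiv ℝ (energy f) u).comp ι)
  obtain ⟨hΦ, hΦ'⟩ := contDiffAt_prod_comp_and_fderiv_apply (hf.contDiffAt_fderiv_energy hu) μc ι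
  change ContDiffAt ℝ ∞ Φ (k v) at hΦ
  have hinj : Function.Injective (fderiv ℝ Φ (k v)) := by
    rw [injective_iff_map_eq_zero]
    intro w hw
    rw [hΦ', Prod.mk_eq_zero] at hw
    have h3 := DFunLike.congr_fun hw.2 (⟨w, hw.1⟩ : LinearMap.ker μ)
    rw [ContinuousLinearMap.comp_apply, hι] at h3
    by_contra hw0
    exact (hf.strongly_convex _ hu w hw0).ne' h3
  have hdim : Module.finrank ℝ V = Module.finrank ℝ (W × (LinearMap.ker μ →L[ℝ] ℝ)) := by
    rw [Module.finrank_prod, ← (LinearMap.toContinuousLinearMap (𝕜 := ℝ)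
      (E := LinearMap.ker μ) (F' := ℝ)).finrank_eq, Module.finrank_linearMap_self,
      ← LinearMap.finrank_range_add_finrank_ker μ, LinearMap.range_eq_top.2 hμ, finrank_top]
  have hkv : Φ (k v) = (v, 0) := by
    refine Prod.ext (hk v).1 ?_
    ext w
    exact (hk v).2 _ ((congrArg μ (hι w)).trans w.2)
  obtain ⟨ψ, hψ, hright⟩ := exists_contDiffAt_rightInverse hΦ hinj hdim
  rw [hkv] at hψ hright
  have hζ : ContDiffAt ℝ ∞ (fun v' : W => (v', (0 : LinearMap.ker μ →L[ℝ] ℝ))) v :=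
    contDiffAt_id.prodMk contDiffAt_const
  refine (ContDiffAt.comp v hψ hζ).congr_of_eventuallyEq ?_
  filter_upwards [hζ.continuousAt.eventually hright] with v' hv'
  have h1 : μ (ψ (v', 0)) = v' := congrArg Prod.fst hv'
  have h2 := eq_of_critical hf hk (u := ψ (v', 0)) fun w hw => by
    have := DFunLike.congr_fun (congrArg Prod.snd hv') (⟨w, hw⟩ : LinearMap.ker μ)
    change fderiv ℝ (energy f) (ψ (v', 0)) (ι ⟨w, hw⟩) = 0 at this
    rwa [hι] at this
  rw [h1] at h2
  exact h2.symm

theorem continuous (hf : IsMinkowskiNorm f) (hk : IsCriticalLift f μ k) : Continuous k := by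
  rw [continuous_iff_continuousAt]
  intro v
  rcases eq_or_ne v 0 with rfl | hv
  swap
  · exact (contDiffAt hf hk hv).continuousAt
  -- At the origin, compare `k` with a linear section of `μ`.
  have hμ : Function.Surjective μ := fun v => ⟨k v, (hk v).1⟩
  obtain ⟨s, hs⟩ := μ.exists_rightInverse_of_surjective (LinearMap.range_eq_top.2 hμ)
  obtain ⟨C, hC, hCf⟩ := hf.exists_upper_bound
  obtain ⟨c, hc, hcf⟩ := hf.exists_lower_bound
  rw [ContinuousAt, map_zero hf hk, tendsto_zero_iff_norm_tendsto_zero]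
  have hlim : Tendsto (fun v => c⁻¹ * (C * ‖s v‖)) (𝓝 0) (𝓝 0) := by
    have h1 : Continuous fun v => c⁻¹ * (C * ‖s v‖) := by
      have := s.continuous_of_finiteDimensional
      fun_prop
    simpa using h1.tendsto 0
  refine squeeze_zero (fun _ => norm_nonneg _) (fun v => ?_) hlim
  have h2 : μ (s v) = v := LinearMap.congr_fun hs v
  have h3 := apply_le hf hk (s v)
  rw [h2] at h3
  rw [le_inv_mul_iff₀ hc]
  exact ((hcf _).trans h3).trans (hCf _)

theorem isHomogeneousNonlinearLift (hf : IsMinkowskiNorm f) (hk : IsCriticalLift f μ k) :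
    IsHomogeneousNonlinearLift μ k where
  continuous := continuous hf hk
  smooth _ hv := (contDiffAt hf hk hv).contDiffWithinAt
  section_eq v := (hk v).1
  homogeneous := homogeneous hf hk

/-- The minimum of a Minkowski norm along the fibres of a linear surjection is a Minkowski norm.
As `dE` vanishes on `ker μ` at the points `k v`, the Hessian of the quotient energy at `v` in the
direction `w` is the Hessian of `E` at `k v` in the direction `k'(v) w`. -/
theorem isMinkowskiNorm_comp (hf : IsMinkowskiNorm f) (hk : IsCriticalLift f μ k) :
    IsMinkowskiNorm (f ∘ k) where
  nonneg v := hf.nonneg _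
  continuous := hf.continuous.comp (continuous hf hk)
  smooth v hv := ((hf.contDiffAt (apply_ne_zero hk hv)).comp v
    (contDiffAt hf hk hv)).contDiffWithinAt
  homogeneous c v hc := by
    simp only [Function.comp_apply]
    rw [homogeneous hf hk c v hc, hf.homogeneous _ _ hc]
  strongly_convex v hv w hw := by
    have hμ : Function.Surjective μ := fun v => ⟨k v, (hk v).1⟩
    let μc : V →L[ℝ] W := LinearMap.toContinuousLinearMap μ
    have hkd : ∀ {v : W}, v ≠ 0 → HasFDerivAt k (fderiv ℝ k v) v := fun hv =>
      ((contDiffAt hf hk hv).differentiableAt (by simp)).hasFDerivAt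
    have hμk : ∀ {v : W}, v ≠ 0 → ∀ w, μ (fderiv ℝ k v w) = w := by
      intro v hv w
      have h1 : HasFDerivAt (fun v => μc (k v)) (μc ∘L fderiv ℝ k v) v :=
        μc.hasFDerivAt.comp v (hkd hv)
      have h2 : (fun v => μc (k v)) = id := funext fun v => (hk v).1
      rw [h2] at h1
      exact DFunLike.congr_fun (h1.unique (hasFDerivAt_id v)) w
    obtain ⟨s, hs⟩ := μ.exists_rightInverse_of_surjective (LinearMap.range_eq_top.2 hμ)
    have hs' : ∀ w, μ (s w) = w := LinearMap.congr_fun hs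
    have hd1 : ∀ {v : W}, v ≠ 0 → ∀ w, fderiv ℝ (energy (f ∘ k)) v w =
        fderiv ℝ (energy f) (k v) (s w) := by
      intro v hv w
      have h1 : HasFDerivAt (energy (f ∘ k)) (fderiv ℝ (energy f) (k v) ∘L fderiv ℝ k v) v :=
        (hf.hasFDerivAt_energy (apply_ne_zero hk hv)).comp v (hkd hv)
      rw [h1.fderiv, ContinuousLinearMap.comp_apply, ← sub_eq_zero, ← map_sub]
      refine (hk v).2 _ ?_
      rw [map_sub, hμk hv, hs', sub_self]
    have hd2 : ∀ y : V, HasFDerivAt (fun v => fderiv ℝ (energy f) (k v) y)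
        (((fderiv ℝ (fderiv ℝ (energy f)) (k v)) ∘L fderiv ℝ k v).flip y) v := by
      intro y
      have h1 := (hf.hasFDerivAt_fderiv_energy (apply_ne_zero hk hv)).comp v (hkd hv)
      exact hasFDerivAt_clm_apply_const h1 y
    have hdd : ∀ y, μ y = 0 → fderiv ℝ (fderiv ℝ (energy f)) (k v) (fderiv ℝ k v w) y = 0 := by
      intro y hy
      have h1 : (fun v => fderiv ℝ (energy f) (k v) y) = fun _ => 0 :=
        funext fun v => (hk v).2 y hy
      have h2 := hd2 y
      rw [h1] at h2
      exact DFunLike.congr_fun (h2.unique (hasFDerivAt_const (0 : ℝ) v)) w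
    have hdiff : DifferentiableAt ℝ (fderiv ℝ (energy (f ∘ k))) v := by
      have h1 : ContDiffAt ℝ ∞ (energy (f ∘ k)) v :=
        (hf.contDiffAt_energy (apply_ne_zero hk hv)).comp v (contDiffAt hf hk hv)
      exact (h1.fderiv_right (m := ∞) (by simp)).differentiableAt (by simp)
    have h3 : HasFDerivAt (fun v => fderiv ℝ (energy (f ∘ k)) v w)
        ((fderiv ℝ (fderiv ℝ (energy (f ∘ k))) v).flip w) v :=
      hasFDerivAt_clm_apply_const hdiff.hasFDerivAt w
    have h4 : (fun v => fderiv ℝ (energy (f ∘ k)) v w) =ᶠ[𝓝 v]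
        fun v => fderiv ℝ (energy f) (k v) (s w) := by
      filter_upwards [isOpen_compl_singleton.mem_nhds hv] with v' hv'
      exact hd1 hv' w
    have h5 : fderiv ℝ (fderiv ℝ (energy (f ∘ k))) v w w =
        fderiv ℝ (fderiv ℝ (energy f)) (k v) (fderiv ℝ k v w) (s w) :=
      DFunLike.congr_fun (h3.unique ((hd2 (s w)).congr_of_eventuallyEq h4)) w
    have h6 : fderiv ℝ (fderiv ℝ (energy f)) (k v) (fderiv ℝ k v w) (s w) =
        fderiv ℝ (fderiv ℝ (energy f)) (k v) (fderiv ℝ k v w) (fderiv ℝ k v w) := by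
      rw [← sub_eq_zero, ← map_sub]
      refine hdd _ ?_
      rw [map_sub, hμk hv, hs', sub_self]
    rw [h5, h6]
    refine hf.strongly_convex _ (apply_ne_zero hk hv) _ fun h => hw ?_
    rw [← hμk hv w, h, _root_.map_zero]

theorem isMinkowskiSubmersion (hf : IsMinkowskiNorm f) (hk : IsCriticalLift f μ k) :
    IsMinkowskiSubmersion μ f (f ∘ k) := by
  refine ⟨fun v => ⟨k v, (hk v).1⟩, ?_⟩
  rw [hf.closure_lt_one, (isMinkowskiNorm_comp hf hk).closure_lt_one]
  refine Set.Subset.antisymm ?_ fun v hv => ⟨k v, hv, (hk v).1⟩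
  rintro _ ⟨u, hu, rfl⟩
  exact (apply_le hf hk u).trans hu

end IsCriticalLift

/-- The norm on the target of a Minkowski submersion is determined by that on the source. -/
theorem IsMinkowskiSubmersion.unique [FiniteDimensional ℝ W] {μ : V →ₗ[ℝ] W} {f : V → ℝ}
    {f₁ f₂ : W → ℝ} (h₁ : IsMinkowskiNorm f₁) (h₂ : IsMinkowskiNorm f₂)
    (hs₁ : IsMinkowskiSubmersion μ f f₁) (hs₂ : IsMinkowskiSubmersion μ f f₂) : f₁ = f₂ := by
  refine eq_of_setOf_le_one_eq h₁.nonneg h₂.nonneg h₁.homogeneous h₂.homogeneous ?_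
  rw [← h₁.closure_lt_one, ← h₂.closure_lt_one, ← hs₁.2, ← hs₂.2]

end Minkowski

/-! ### Smooth maps into and between tangent bundles -/

section TangentBundle

variable {E : Type*} [NormedAddCommGroup E] [NormedSpace ℝ E]
  {M : Type*} [TopologicalSpace M] [ChartedSpace E M]
  {E' : Type*} [NormedAddCommGroup E'] [NormedSpace ℝ E']
  {N : Type*} [TopologicalSpace N] [ChartedSpace E' N]
  {EX : Type*} [NormedAddCommGroup EX] [NormedSpace ℝ EX] {HX : Type*} [TopologicalSpace HX]
  {IX : ModelWithCorners ℝ EX HX} {X : Type*} [TopologicalSpace X] [ChartedSpace HX X]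

theorem tangentBundle_mk_congr {m m' : M} (hm : m = m') (u : E) :
    (TotalSpace.mk' E m u : TangentBundle 𝓘(ℝ, E) M) = TotalSpace.mk' E m' u := by
  subst hm
  rfl

theorem trivializationAt_tangentBundle_self [IsManifold 𝓘(ℝ, E) ∞ M] (m : M) (u : E) :
    (trivializationAt E (TangentSpace 𝓘(ℝ, E)) m (TotalSpace.mk' E m u)).2 = u := by
  have h : tangentCoordChange 𝓘(ℝ, E) m m m u = u :=
    tangentCoordChange_self (mem_extChartAt_source m)
  exact h

/-- A map into a single tangent space is smooth as a map into the tangent bundle if and only if it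
is smooth as a map into the model space. -/
theorem contMDiffAt_tangentBundle_mk_iff [IsManifold 𝓘(ℝ, E) ∞ M] (m : M) {f : X → E} {x : X} :
    ContMDiffAt IX 𝓘(ℝ, E).tangent ∞
      (fun x => (TotalSpace.mk' E m (f x) : TangentBundle 𝓘(ℝ, E) M)) x ↔
      ContMDiffAt IX 𝓘(ℝ, E) ∞ f x := by
  rw [contMDiffAt_totalSpace]
  simp only [trivializationAt_tangentBundle_self]
  exact and_iff_right contMDiffAt_const

/-- A smooth map into the tangent bundle whose base point is locally constant has a smooth
fibre component. -/
theorem contMDiffAt_snd_of_eventually_proj_eq [IsManifold 𝓘(ℝ, E) ∞ M] (m : M)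
    {f : X → TangentBundle 𝓘(ℝ, E) M} {x : X} (hf : ContMDiffAt IX 𝓘(ℝ, E).tangent ∞ f x)
    (hm : ∀ᶠ y in 𝓝 x, (f y).1 = m) :
    ContMDiffAt IX 𝓘(ℝ, E) ∞ (fun y => (show E from (f y).2)) x := by
  rw [← contMDiffAt_tangentBundle_mk_iff (M := M) m]
  refine hf.congr_of_eventuallyEq ?_
  filter_upwards [hm] with y hy
  subst hy
  rfl

/-- The canonical map from the pullback `q^*TN` to `TN` is smooth: in the trivializations that
define the two manifold structures it is `q` on the base and the identity on the fibres. -/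
theorem contMDiff_pullback_lift [IsManifold 𝓘(ℝ, E) ∞ M] [IsManifold 𝓘(ℝ, E') ∞ N] (q : C(M, N))
    (hq : ContMDiff 𝓘(ℝ, E) 𝓘(ℝ, E') ∞ q) :
    ContMDiff (𝓘(ℝ, E).prod 𝓘(ℝ, E')) 𝓘(ℝ, E').tangent ∞
      (fun p : TotalSpace E' (q *ᵖ (TangentSpace 𝓘(ℝ, E') : N → Type _)) =>
        (TotalSpace.mk' E' (q p.1) p.2 : TangentBundle 𝓘(ℝ, E') N)) := by
  intro p
  have h := contMDiffAt_id (n := ∞) (I := 𝓘(ℝ, E).prod 𝓘(ℝ, E')) (x := p)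
  rw [contMDiffAt_totalSpace] at h ⊢
  exact ⟨(hq _).comp p h.1, h.2⟩

/-- For a smooth family `α a : N → P` of maps, the tangent maps `(a, p) ↦ T(α a) p` form a smooth
family: `T(α a)` is the tangent map of `α`, applied to vectors with zero component along the
parameter. -/
theorem contMDiff_tangentMap_family {P : Type*} [TopologicalSpace P] {EP : Type*}
    [NormedAddCommGroup EP] [NormedSpace ℝ EP] [ChartedSpace EP P]
    [IsManifold 𝓘(ℝ, E) ∞ M] [IsManifold 𝓘(ℝ, E') ∞ N] [IsManifold 𝓘(ℝ, EP) ∞ P]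
    {α : M → N → P}
    (hα : ContMDiff (𝓘(ℝ, E).prod 𝓘(ℝ, E')) 𝓘(ℝ, EP) ∞ (fun x : M × N => α x.1 x.2)) :
    ContMDiff (𝓘(ℝ, E).prod 𝓘(ℝ, E').tangent) 𝓘(ℝ, EP).tangent ∞
      (fun x : M × TangentBundle 𝓘(ℝ, E') N =>
        tangentMap 𝓘(ℝ, E') 𝓘(ℝ, EP) (α x.1) x.2) := by
  have : IsManifold 𝓘(ℝ, E) 1 M := .of_le (n := ∞) (by simp)
  have : IsManifold 𝓘(ℝ, E') 1 N := .of_le (n := ∞) (by simp)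
  have : IsManifold 𝓘(ℝ, EP) 1 P := .of_le (n := ∞) (by simp)
  have h1 : ContMDiff (𝓘(ℝ, E).prod 𝓘(ℝ, E')).tangent 𝓘(ℝ, EP).tangent ∞
      (tangentMap (𝓘(ℝ, E).prod 𝓘(ℝ, E')) 𝓘(ℝ, EP) (fun x : M × N => α x.1 x.2)) :=
    hα.contMDiff_tangentMap (by simp)
  have h2 : ContMDiff 𝓘(ℝ, E) 𝓘(ℝ, E).tangent ∞
      (fun m : M => (TotalSpace.mk' E m 0 : TangentBundle 𝓘(ℝ, E) M)) :=
    contMDiff_zeroSection ℝ (TangentSpace 𝓘(ℝ, E) : M → Type _)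
  have h3 := h1.comp ((contMDiff_equivTangentBundleProd_symm (n := ∞) (I := 𝓘(ℝ, E)) (M := M)
    (I' := 𝓘(ℝ, E')) (M' := N)).comp ((h2.comp contMDiff_fst).prodMk contMDiff_snd))
  refine h3.congr fun x => ?_
  obtain ⟨a, y, v⟩ := x
  refine congrArg (TotalSpace.mk' EP (α a y)) ?_
  have h4 := mfderiv_prod_eq_add_apply (p := (a, y))
    (v := (show TangentSpace (𝓘(ℝ, E).prod 𝓘(ℝ, E')) (a, y) from ((0 : E), v)))
    ((hα (a, y)).mdifferentiableAt (by simp))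
  refine Eq.trans ?_ h4.symm
  dsimp only
  rw [show (mfderiv 𝓘(ℝ, E) 𝓘(ℝ, EP) (fun z => α z y) a) (0 : E) = 0 from map_zero _, zero_add]

end TangentBundle

/-! ### Submersions -/

section Submersion

variable {E : Type*} [NormedAddCommGroup E] [NormedSpace ℝ E]
  {M : Type*} [TopologicalSpace M] [ChartedSpace E M]
  {E' : Type*} [NormedAddCommGroup E'] [NormedSpace ℝ E']
  {N : Type*} [TopologicalSpace N] [ChartedSpace E' N]

/-- Charts in which a submersion is a linear map `L`, with a linear right inverse `R`. -/
theorem exists_submersion_charts {q : M → N} {m : M}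
    (h : Manifold.IsSubmersionAt 𝓘(ℝ, E) 𝓘(ℝ, E') ∞ q m) :
    ∃ (φ : OpenPartialHomeomorph M E) (ψ : OpenPartialHomeomorph N E')
      (L : E →L[ℝ] E') (R : E' →L[ℝ] E), m ∈ φ.source ∧ q m ∈ ψ.source ∧
      ContMDiffOn 𝓘(ℝ, E) 𝓘(ℝ, E) ∞ φ φ.source ∧ ContMDiffOn 𝓘(ℝ, E) 𝓘(ℝ, E) ∞ φ.symm φ.target ∧
      ContMDiffOn 𝓘(ℝ, E') 𝓘(ℝ, E') ∞ ψ ψ.source ∧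
      (∀ v, L (R v) = v) ∧ (∀ x ∈ φ.source, q x ∈ ψ.source) ∧
      ∀ x ∈ φ.target, ψ (q (φ.symm x)) = L x := by
  refine ⟨h.domChart, h.codChart,
    (ContinuousLinearMap.fst ℝ E' h.complement).comp (h.equiv : E →L[ℝ] E' × h.complement),
    (h.equiv.symm : (E' × h.complement) →L[ℝ] E).comp (ContinuousLinearMap.inl ℝ E' h.complement),
    h.mem_domChart_source, h.mem_codChart_source,
    contMDiffOn_of_mem_maximalAtlas h.domChart_mem_maximalAtlas,
    contMDiffOn_symm_of_mem_maximalAtlas h.domChart_mem_maximalAtlas,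
    contMDiffOn_of_mem_maximalAtlas h.codChart_mem_maximalAtlas, fun v => ?_,
    fun x hx => h.source_subset_preimage_source hx, fun x hx => ?_⟩
  · simp
  · have hw := h.writtenInCharts
    have hx' : x ∈ (h.domChart.extend 𝓘(ℝ, E)).target := by simpa using hx
    simpa using hw hx'

/-- A submersion has a smooth local section through every point. -/
theorem exists_local_section {q : M → N} {m : M}
    (h : Manifold.IsSubmersionAt 𝓘(ℝ, E) 𝓘(ℝ, E') ∞ q m) :
    ∃ σ : N → M, ContMDiffAt 𝓘(ℝ, E') 𝓘(ℝ, E) ∞ σ (q m) ∧ σ (q m) = m ∧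
      ∀ᶠ y in 𝓝 (q m), q (σ y) = y := by
  obtain ⟨φ, ψ, L, R, hm, hqm, hφ, hφs, hψ, hLR, hmaps, hw⟩ := exists_submersion_charts h
  -- In the charts the section is the affine map through `φ m` with linear part `R`.
  let a : N → E := fun y => φ m + R (ψ y - ψ (q m))
  have ha0 : a (q m) = φ m := by simp [a]
  have ha : ContMDiffAt 𝓘(ℝ, E') 𝓘(ℝ, E) ∞ a (q m) := by
    have h1 : ContDiff ℝ ∞ (fun z : E' => φ m + R (z - ψ (q m))) := by fun_prop
    exact h1.contMDiff.contMDiffAt.comp (q m) (hψ.contMDiffAt (ψ.open_source.mem_nhds hqm))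
  have hat : φ m ∈ φ.target := φ.map_source hm
  have hsym : ContMDiffAt 𝓘(ℝ, E) 𝓘(ℝ, E) ∞ φ.symm (a (q m)) := by
    rw [ha0]; exact hφs.contMDiffAt (φ.open_target.mem_nhds hat)
  refine ⟨fun y => φ.symm (a y), hsym.comp (q m) ha, by simp only [ha0, φ.left_inv hm], ?_⟩
  have hev : ∀ᶠ y in 𝓝 (q m), a y ∈ φ.target :=
    ha.continuousAt.eventually (by rw [ha0]; exact φ.open_target.mem_nhds hat)
  filter_upwards [hev, ψ.open_source.mem_nhds hqm] with y hy hys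
  refine ψ.injOn (hmaps _ (φ.map_target hy)) hys ?_
  rw [hw _ hy]
  have h2 : L (φ m) = ψ (q m) := by rw [← hw _ hat, φ.left_inv hm]
  simp [a, h2, hLR]

theorem surjective_mfderiv_of_isSubmersionAt {q : M → N} {m : M}
    (h : Manifold.IsSubmersionAt 𝓘(ℝ, E) 𝓘(ℝ, E') ∞ q m) :
    Function.Surjective (mfderiv 𝓘(ℝ, E) 𝓘(ℝ, E') q m) := by
  obtain ⟨σ, hσ, hσm, hqσ⟩ := exists_local_section h
  have h1 : HasMFDerivAt 𝓘(ℝ, E') 𝓘(ℝ, E) σ (q m) (mfderiv 𝓘(ℝ, E') 𝓘(ℝ, E) σ (q m)) :=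
    (hσ.mdifferentiableAt (by simp)).hasMFDerivAt
  have h2 : HasMFDerivAt 𝓘(ℝ, E) 𝓘(ℝ, E') q (σ (q m)) (mfderiv 𝓘(ℝ, E) 𝓘(ℝ, E') q (σ (q m))) :=
    ((hσm.symm ▸ h.contMDiffAt : ContMDiffAt 𝓘(ℝ, E) 𝓘(ℝ, E') ∞ q (σ (q m))).mdifferentiableAt
      (by simp)).hasMFDerivAt
  have h3 := (HasMFDerivAt.comp (q m) h2 h1).mfderiv
  have h4 : mfderiv 𝓘(ℝ, E') 𝓘(ℝ, E') (q ∘ σ) (q m) = mfderiv 𝓘(ℝ, E') 𝓘(ℝ, E') id (q m) :=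
    Filter.EventuallyEq.mfderiv_eq hqσ
  intro v
  have key : ∀ m', m' = m → ∀ D : E' →L[ℝ] E,
      (show E →L[ℝ] E' from mfderiv 𝓘(ℝ, E) 𝓘(ℝ, E') q m').comp D = ContinuousLinearMap.id ℝ E' →
      (show E →L[ℝ] E' from mfderiv 𝓘(ℝ, E) 𝓘(ℝ, E') q m) (D v) = v := by
    rintro m' rfl D hD
    exact DFunLike.congr_fun hD v
  refine ⟨mfderiv 𝓘(ℝ, E') 𝓘(ℝ, E) σ (q m) v, key _ hσm _ ?_⟩
  exact (h3.symm.trans h4).trans mfderiv_id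

/-- A vertical vector of a submersion is the velocity of a smooth curve in the fibre: in adapted
charts, of a segment parametrized by `t ↦ δ sin (t / δ)`, whose values stay small for all times. -/
theorem exists_curve_in_fibre {q : M → N} {m : M}
    (h : Manifold.IsSubmersionAt 𝓘(ℝ, E) 𝓘(ℝ, E') ∞ q m) {ξ : E}
    (hξ : (show E →L[ℝ] E' from mfderiv 𝓘(ℝ, E) 𝓘(ℝ, E') q m) ξ = 0) :
    ∃ γ : ℝ → M, ContMDiff 𝓘(ℝ, ℝ) 𝓘(ℝ, E) ∞ γ ∧ γ 0 = m ∧ (∀ t, q (γ t) = q m) ∧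
      (show E from mfderiv 𝓘(ℝ, ℝ) 𝓘(ℝ, E) γ 0 (1 : ℝ)) = ξ := by
  have hq := h.contMDiffAt
  obtain ⟨φ, ψ, L, R, hm, hqm, hφ, hφs, hψ, hLR, hmaps, hw⟩ := exists_submersion_charts h
  have hat : φ m ∈ φ.target := φ.map_source hm
  have hφd : HasMFDerivAt 𝓘(ℝ, E) 𝓘(ℝ, E) φ m (mfderiv 𝓘(ℝ, E) 𝓘(ℝ, E) φ m) :=
    ((hφ.contMDiffAt (φ.open_source.mem_nhds hm)).mdifferentiableAt (by simp)).hasMFDerivAt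
  have hψd : HasMFDerivAt 𝓘(ℝ, E') 𝓘(ℝ, E') ψ (q m) (mfderiv 𝓘(ℝ, E') 𝓘(ℝ, E') ψ (q m)) :=
    ((hψ.contMDiffAt (ψ.open_source.mem_nhds hqm)).mdifferentiableAt (by simp)).hasMFDerivAt
  have hqd : HasMFDerivAt 𝓘(ℝ, E) 𝓘(ℝ, E') q m (mfderiv 𝓘(ℝ, E) 𝓘(ℝ, E') q m) :=
    (hq.mdifferentiableAt (by simp)).hasMFDerivAt
  obtain ⟨Dφ, hDφ⟩ : ∃ D : E →L[ℝ] E, D = mfderiv 𝓘(ℝ, E) 𝓘(ℝ, E) φ m := ⟨_, rfl⟩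
  let η : E := Dφ ξ
  have hLη : L η = 0 := by
    have h1 := HasMFDerivAt.comp m hψd hqd
    have h2 := HasMFDerivAt.comp m L.hasMFDerivAt hφd
    have h3 : (ψ ∘ q) =ᶠ[𝓝 m] (L ∘ φ) := by
      filter_upwards [φ.open_source.mem_nhds hm] with x hx
      have := hw _ (φ.map_source hx)
      rw [φ.left_inv hx] at this
      exact this
    have h4 := hasMFDerivAt_unique (h2.congr_of_eventuallyEq h3) h1
    have h5 : L (Dφ ξ) = (show E' →L[ℝ] E' from mfderiv 𝓘(ℝ, E') 𝓘(ℝ, E') ψ (q m))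
        ((show E →L[ℝ] E' from mfderiv 𝓘(ℝ, E) 𝓘(ℝ, E') q m) ξ) := by
      rw [hDφ]; exact DFunLike.congr_fun h4 ξ
    rw [h5, hξ, map_zero]
  obtain ⟨δ, hδ, hball⟩ : ∃ δ : ℝ, 0 < δ ∧ ∀ s : ℝ, |s| ≤ δ → φ m + s • η ∈ φ.target := by
    have h1 : ContinuousAt (fun s : ℝ => φ m + s • η) 0 := by fun_prop
    have h2 : ∀ᶠ s : ℝ in 𝓝 0, φ m + s • η ∈ φ.target :=
      h1.eventually (by simpa using φ.open_target.mem_nhds hat)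
    obtain ⟨ε, hε, hb⟩ := Metric.eventually_nhds_iff.1 h2
    refine ⟨ε / 2, half_pos hε, fun s hs => hb ?_⟩
    rw [Real.dist_eq, sub_zero]
    linarith
  let s : ℝ → ℝ := fun t => δ * Real.sin (t / δ)
  have hs : ∀ t, φ m + s t • η ∈ φ.target := fun t => hball _ <| by
    rw [abs_mul, abs_of_pos hδ]
    exact mul_le_of_le_one_right hδ.le (Real.abs_sin_le_one _)
  have hs0 : s 0 = 0 := by simp [s]
  let c : ℝ → E := fun t => φ m + s t • η
  have hc : ContDiff ℝ ∞ c := by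
    have : ContDiff ℝ ∞ s := contDiff_const.mul (Real.contDiff_sin.comp (contDiff_id.div_const δ))
    exact contDiff_const.add (this.smul contDiff_const)
  have hc0 : c 0 = φ m := by simp [c, hs0]
  have hcd : HasDerivAt c η 0 := by
    have h1 : HasDerivAt s 1 0 := by
      have h2 := ((hasDerivAt_id (0 : ℝ)).div_const δ).sin.const_mul δ
      simpa [s, hδ.ne'] using h2
    simpa [c] using (h1.smul_const η).const_add (φ m)
  refine ⟨fun t => φ.symm (c t), fun t => ?_, by simp only [hc0, φ.left_inv hm], fun t => ?_, ?_⟩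
  · exact (hφs.contMDiffAt (φ.open_target.mem_nhds (hs t))).comp t hc.contMDiff.contMDiffAt
  · refine ψ.injOn (hmaps _ (φ.map_target (hs t))) hqm ?_
    have h2 : L (φ m) = ψ (q m) := by rw [← hw _ hat, φ.left_inv hm]
    rw [hw _ (hs t), map_add, map_smul, hLη, smul_zero, add_zero, h2]
  · obtain ⟨γ, hγ⟩ : ∃ γ : ℝ → M, γ = fun t => φ.symm (c t) := ⟨_, rfl⟩
    rw [← hγ]
    have hγd : HasMFDerivAt 𝓘(ℝ, ℝ) 𝓘(ℝ, E) γ 0 (mfderiv 𝓘(ℝ, ℝ) 𝓘(ℝ, E) γ 0) := by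
      refine ContMDiffAt.mdifferentiableAt (n := ∞) ?_ (by simp) |>.hasMFDerivAt
      rw [hγ]
      exact (hφs.contMDiffAt (φ.open_target.mem_nhds (hs 0))).comp 0 hc.contMDiff.contMDiffAt
    have hγ0 : γ 0 = m := by rw [hγ]; simp only [hc0, φ.left_inv hm]
    obtain ⟨Dγ, hDγ⟩ : ∃ D : ℝ →L[ℝ] E, D = mfderiv 𝓘(ℝ, ℝ) 𝓘(ℝ, E) γ 0 := ⟨_, rfl⟩
    have hφd' : HasMFDerivAt 𝓘(ℝ, E) 𝓘(ℝ, E) φ (γ 0) Dφ := by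
      have key : ∀ m', m' = m → HasMFDerivAt 𝓘(ℝ, E) 𝓘(ℝ, E) φ m' Dφ := by
        rintro _ rfl
        rw [hDφ]
        exact hφd
      exact key _ hγ0
    have h1 := HasMFDerivAt.comp (0 : ℝ) hφd' hγd
    have h2 : φ ∘ γ = c := by
      funext t
      rw [hγ]
      exact φ.right_inv (hs t)
    rw [h2] at h1
    have h3 := hasMFDerivAt_unique h1 hcd.hasFDerivAt.hasMFDerivAt
    have h4 : Dφ (Dγ 1) = Dφ ξ := by
      have := DFunLike.congr_fun h3 (1 : ℝ)
      rw [hDγ]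
      exact this.trans (one_smul ℝ _)
    -- `Dφ` is injective, being inverted by the derivative of `φ.symm`.
    have hinv : HasMFDerivAt 𝓘(ℝ, E) 𝓘(ℝ, E) φ.symm (φ m)
        (mfderiv 𝓘(ℝ, E) 𝓘(ℝ, E) φ.symm (φ m)) :=
      ((hφs.contMDiffAt (φ.open_target.mem_nhds hat)).mdifferentiableAt (by simp)).hasMFDerivAt
    have h5 := HasMFDerivAt.comp m hinv hφd
    have h6 : (φ.symm ∘ φ) =ᶠ[𝓝 m] id := by
      filter_upwards [φ.open_source.mem_nhds hm] with x hx
      exact φ.left_inv hx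
    have h7 := hasMFDerivAt_unique h5 ((hasMFDerivAt_id (I := 𝓘(ℝ, E)) m).congr_of_eventuallyEq h6)
    have hinj : Function.Injective Dφ := by
      refine Function.LeftInverse.injective
        (g := (show E →L[ℝ] E from mfderiv 𝓘(ℝ, E) 𝓘(ℝ, E) φ.symm (φ m))) fun x => ?_
      rw [hDφ]
      exact DFunLike.congr_fun h7 x
    rw [← hDγ]
    exact hinj h4

end Submersion

/-! ### Finsler functions on tangent spaces -/

section ModelDerivative

variable {E : Type*} [NormedAddCommGroup E] [NormedSpace ℝ E]
  {M : Type*} [TopologicalSpace M] [ChartedSpace E M]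
  {E' : Type*} [NormedAddCommGroup E'] [NormedSpace ℝ E']
  {N : Type*} [TopologicalSpace N] [ChartedSpace E' N]
  {E'' : Type*} [NormedAddCommGroup E''] [NormedSpace ℝ E'']
  {P : Type*} [TopologicalSpace P] [ChartedSpace E'' P]

/-- The manifold derivative, as a map between the model spaces. All tangent spaces being the model
space, this allows rewriting the base point. -/
def modelDeriv (E E' : Type*) [NormedAddCommGroup E] [NormedSpace ℝ E] [NormedAddCommGroup E']
    [NormedSpace ℝ E'] {M N : Type*} [TopologicalSpace M] [ChartedSpace E M] [TopologicalSpace N]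
    [ChartedSpace E' N] (f : M → N) (m : M) : E →L[ℝ] E' :=
  mfderiv 𝓘(ℝ, E) 𝓘(ℝ, E') f m

theorem modelDeriv_comp_apply {f : N → P} {g : M → N} (hf : ContMDiff 𝓘(ℝ, E') 𝓘(ℝ, E'') ∞ f)
    (hg : ContMDiff 𝓘(ℝ, E) 𝓘(ℝ, E') ∞ g) (m : M) (u : E) :
    modelDeriv E E'' (fun x => f (g x)) m u = modelDeriv E' E'' f (g m) (modelDeriv E E' g m u) :=
  DFunLike.congr_fun (mfderiv_comp m ((hf _).mdifferentiableAt (by simp))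
    ((hg _).mdifferentiableAt (by simp))) u

theorem modelDeriv_id_apply (m : M) (u : E) : modelDeriv E E (fun x : M => x) m u = u :=
  DFunLike.congr_fun (mfderiv_id (I := 𝓘(ℝ, E)) (x := m)) u

/-- The restrictions of a Finsler function to the tangent spaces are Minkowski norms. -/
theorem IsFinslerFunction.isMinkowskiNorm [IsManifold 𝓘(ℝ, E) ∞ M]
    {F : TangentBundle 𝓘(ℝ, E) M → ℝ} (hF : IsFinslerFunction F) (m : M) :
    IsMinkowskiNorm (fibreFunction F m) where
  nonneg u := hF.nonneg _
  continuous := hF.continuous.comp (continuous_iff_continuousAt.2 fun _ =>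
    ((contMDiffAt_tangentBundle_mk_iff (IX := 𝓘(ℝ, E)) m).2 contMDiffAt_id).continuousAt)
  smooth u hu := by
    have h1 : ContMDiffAt 𝓘(ℝ, E) 𝓘(ℝ, E).tangent ∞
        (fun u : E => (TotalSpace.mk' E m u : TangentBundle 𝓘(ℝ, E) M)) u :=
      (contMDiffAt_tangentBundle_mk_iff m).2 contMDiffAt_id
    have h2 := (hF.smooth (TotalSpace.mk' E m u) hu).comp (s := {0}ᶜ) u
      h1.contMDiffWithinAt fun w hw => hw
    exact contMDiffWithinAt_iff_contDiffWithinAt.1 h2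
  homogeneous c u hc := hF.homogeneous c m u hc
  strongly_convex u hu w hw := hF.strongly_convex m u hu w hw

/-- The subduced Finsler function of a Finsler submersion is determined by the Finsler function on
the source. -/
theorem IsFinslerSubmersion.unique [FiniteDimensional ℝ E'] [IsManifold 𝓘(ℝ, E') ∞ N] {q : M → N}
    {F₁ : TangentBundle 𝓘(ℝ, E) M → ℝ} {F F₂ : TangentBundle 𝓘(ℝ, E') N → ℝ}
    (hF : IsFinslerFunction F) (hF₂ : IsFinslerFunction F₂) (hq : IsFinslerSubmersion q F₁ F)
    (hq₂ : IsFinslerSubmersion q F₁ F₂) : F = F₂ := by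
  funext ⟨x, v⟩
  obtain ⟨m, rfl⟩ := hq.2.1 x
  exact congrFun (IsMinkowskiSubmersion.unique (μ := (modelDeriv E E' q m).toLinearMap)
    (f := fibreFunction F₁ m) (hF.isMinkowskiNorm (q m)) (hF₂.isMinkowskiNorm (q m))
    (hq.2.2 m) (hq₂.2.2 m)) v

end ModelDerivative

/-! ### The projection of a Lie group onto a homogeneous space -/

section HomogeneousSpace

variable {E : Type*} [NormedAddCommGroup E] [NormedSpace ℝ E]
  {E' : Type*} [NormedAddCommGroup E'] [NormedSpace ℝ E']
  {G : Type*} [TopologicalSpace G] [ChartedSpace E G] [Group G]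
  {H : Subgroup G}

theorem fibreFunction_mul_left {F₁ : TangentBundle 𝓘(ℝ, E) G → ℝ}
    (hleft : IsLeftInvariant F₁) (a g : G) (u : E) :
    fibreFunction F₁ (a * g) (modelDeriv E E (fun x : G => a * x) g u) = fibreFunction F₁ g u :=
  hleft a (TotalSpace.mk' E g u)

theorem fibreFunction_mul_right {F₁ : TangentBundle 𝓘(ℝ, E) G → ℝ}
    (hright : IsRightInvariantUnder H F₁) {a : G} (ha : a ∈ H) (g : G) (u : E) :
    fibreFunction F₁ (g * a) (modelDeriv E E (fun x : G => x * a) g u) = fibreFunction F₁ g u :=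
  hright a ha (TotalSpace.mk' E g u)

variable [LieGroup 𝓘(ℝ, E) ∞ G] [ChartedSpace E' (G ⧸ H)]

theorem cosetProj_surjective : Function.Surjective (cosetProj H) := QuotientGroup.mk_surjective

theorem inv_smul_eq_cosetProj_one {g : G} {x : G ⧸ H} (hx : cosetProj H g = x) :
    g⁻¹ • x = cosetProj H 1 := by
  subst hx
  change ((g⁻¹ * g : G) : G ⧸ H) = ((1 : G) : G ⧸ H)
  rw [inv_mul_cancel]

/-- The Lie algebra of `H`, defined by velocities of curves in `H`, is the kernel of the tangent map
at `e` of the projection `G → G/H`. -/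
theorem mem_subgroupLieAlgebra_iff
    (hsub : Manifold.IsSubmersion 𝓘(ℝ, E) 𝓘(ℝ, E') ∞ (cosetProj H)) {ξ : E} :
    ξ ∈ subgroupLieAlgebra E H ↔ modelDeriv E E' (cosetProj H) 1 ξ = 0 := by
  constructor
  · rintro ⟨γ, hγ, h0, hH, rfl⟩
    have h1 : (fun t => cosetProj H (γ t)) = fun _ => cosetProj H 1 :=
      funext fun t => by
      simpa using! QuotientGroup.mk_mul_of_mem (1 : G) (hH t)
    have h2 := modelDeriv_comp_apply hsub.contMDiff hγ 0 1
    rw [h1, h0] at h2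
    refine h2.symm.trans ?_
    have h3 : modelDeriv ℝ E' (fun _ : ℝ => cosetProj H (1 : G)) 0 = 0 := mfderiv_const
    rw [h3]
    rfl
  · intro hξ
    obtain ⟨γ, hγ, h0, hH, hv⟩ := exists_curve_in_fibre (hsub.isSubmersionAt 1) hξ
    refine ⟨γ, hγ, h0, fun t => ?_, hv⟩
    have h1 : ((1 : G) : G ⧸ H) = γ t := (hH t).symm
    rw [QuotientGroup.eq] at h1
    simpa using h1

theorem modelDeriv_proj_mul_right
    (hsub : Manifold.IsSubmersion 𝓘(ℝ, E) 𝓘(ℝ, E') ∞ (cosetProj H)) {a : G} (ha : a ∈ H)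
    (g : G) (u : E) :
    modelDeriv E E' (cosetProj H) (g * a) (modelDeriv E E (fun x : G => x * a) g u) =
      modelDeriv E E' (cosetProj H) g u := by
  rw [← modelDeriv_comp_apply hsub.contMDiff (contMDiff_mul_right (a := a))]
  have h : (fun x => cosetProj H (x * a)) = cosetProj H :=
    funext fun x => QuotientGroup.mk_mul_of_mem x ha
  rw [h]

theorem surjective_modelDeriv_mul_left (a g : G) :
    Function.Surjective (modelDeriv E E (fun x : G => a * x) g) := fun u => by
  refine ⟨modelDeriv E E (fun x : G => a⁻¹ * x) (a * g) u, ?_⟩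
  have h := modelDeriv_comp_apply (contMDiff_mul_left (I := 𝓘(ℝ, E)) (n := ∞) (a := a))
    (contMDiff_mul_left (I := 𝓘(ℝ, E)) (n := ∞) (a := a⁻¹)) (a * g) u
  simp only [mul_inv_cancel_left, inv_mul_cancel_left] at h
  rw [← h]
  exact modelDeriv_id_apply _ u

theorem surjective_modelDeriv_mul_right (a g : G) :
    Function.Surjective (modelDeriv E E (fun x : G => x * a) g) := fun u => by
  refine ⟨modelDeriv E E (fun x : G => x * a⁻¹) (g * a) u, ?_⟩
  have h := modelDeriv_comp_apply (contMDiff_mul_right (I := 𝓘(ℝ, E)) (n := ∞) (a := a))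
    (contMDiff_mul_right (I := 𝓘(ℝ, E)) (n := ∞) (a := a⁻¹)) (g * a) u
  simp only [inv_mul_cancel_right, mul_inv_cancel_right] at h
  rw [← h]
  exact modelDeriv_id_apply _ u

theorem adjointAction_apply (a : G) (u : E) :
    adjointAction E a u = modelDeriv E E (fun x : G => x * a⁻¹) (a * 1)
      (modelDeriv E E (fun x : G => a * x) 1 u) :=
  modelDeriv_comp_apply (contMDiff_mul_right (I := 𝓘(ℝ, E)) (n := ∞) (a := a⁻¹))
    (contMDiff_mul_left (I := 𝓘(ℝ, E)) (n := ∞) (a := a)) 1 u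

/-- The restriction of the tangent map of `G → G/H` to a complement of the Lie algebra of `H` is an
isomorphism. -/
theorem exists_linearEquiv_of_isCompl
    (hsub : Manifold.IsSubmersion 𝓘(ℝ, E) 𝓘(ℝ, E') ∞ (cosetProj H)) {𝔪 : Submodule ℝ E}
    (h𝔪 : IsCompl 𝔪 (subgroupLieAlgebra E H)) :
    ∃ β : 𝔪 ≃ₗ[ℝ] E', (∀ ζ : 𝔪, β ζ = modelDeriv E E' (cosetProj H) 1 ζ) ∧
      ∀ u : E, β (𝔪.projectionOnto _ h𝔪 u) = modelDeriv E E' (cosetProj H) 1 u := by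
  have hproj : ∀ u : E, modelDeriv E E' (cosetProj H) 1 (𝔪.projectionOnto _ h𝔪 u : E) =
      modelDeriv E E' (cosetProj H) 1 u := by
    intro u
    rw [← sub_eq_zero, ← map_sub, ← mem_subgroupLieAlgebra_iff hsub,
      ← Submodule.projectionOnto_apply_eq_zero_iff h𝔪, map_sub,
      Submodule.projectionOnto_apply_left, sub_self]
  let B : 𝔪 →ₗ[ℝ] E' := (modelDeriv E E' (cosetProj H) 1).toLinearMap ∘ₗ 𝔪.subtype
  have hinj : Function.Injective B := by
    rw [injective_iff_map_eq_zero]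
    intro ζ hζ
    have h1 : (ζ : E) ∈ subgroupLieAlgebra E H := (mem_subgroupLieAlgebra_iff hsub).2 hζ
    exact Subtype.ext (Submodule.disjoint_def.1 h𝔪.disjoint _ ζ.2 h1)
  have hsurj : Function.Surjective B := by
    intro v
    obtain ⟨u, hu⟩ := surjective_mfderiv_of_isSubmersionAt (hsub.isSubmersionAt 1) v
    exact ⟨𝔪.projectionOnto _ h𝔪 u, (hproj u).trans hu⟩
  exact ⟨LinearEquiv.ofBijective B ⟨hinj, hsurj⟩, fun ζ => rfl, hproj⟩

/-- The action of `G` on `G/H` is smooth: in terms of a local section `σ` of the projection it is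
`(a, x) ↦ a σ(x) H`. -/
theorem contMDiff_smul_quotient
    (hsub : Manifold.IsSubmersion 𝓘(ℝ, E) 𝓘(ℝ, E') ∞ (cosetProj H)) :
    ContMDiff (𝓘(ℝ, E).prod 𝓘(ℝ, E')) 𝓘(ℝ, E') ∞ (fun p : G × (G ⧸ H) => p.1 • p.2) := by
  rintro ⟨a, x⟩
  obtain ⟨g, rfl⟩ := cosetProj_surjective (H := H) x
  obtain ⟨σ, hσ, -, hqσ⟩ := exists_local_section (hsub.isSubmersionAt g)
  have h1 : ContMDiffAt (𝓘(ℝ, E).prod 𝓘(ℝ, E')) 𝓘(ℝ, E') ∞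
      (fun p : G × (G ⧸ H) => cosetProj H (p.1 * σ p.2)) (a, cosetProj H g) :=
    hsub.contMDiff.contMDiffAt.comp _
      (contMDiffAt_fst.mul (hσ.comp (a, cosetProj H g) contMDiffAt_snd))
  refine h1.congr_of_eventuallyEq ?_
  filter_upwards [(continuous_snd.tendsto (a, cosetProj H g)).eventually hqσ] with p hp
  conv_lhs => rw [← hp]
  rfl

theorem contMDiff_smul_quotient_left
    (hsub : Manifold.IsSubmersion 𝓘(ℝ, E) 𝓘(ℝ, E') ∞ (cosetProj H)) (a : G) :
    ContMDiff 𝓘(ℝ, E') 𝓘(ℝ, E') ∞ (fun x : G ⧸ H => a • x) :=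
  (contMDiff_smul_quotient hsub).comp (contMDiff_const.prodMk contMDiff_id)

theorem modelDeriv_inv_smul_smul
    (hsub : Manifold.IsSubmersion 𝓘(ℝ, E) 𝓘(ℝ, E') ∞ (cosetProj H)) (a : G) {x y : G ⧸ H}
    (hy : y = a • x) (v : E') :
    modelDeriv E' E' (fun x : G ⧸ H => a⁻¹ • x) y (modelDeriv E' E' (fun x : G ⧸ H => a • x) x v) =
      v := by
  subst hy
  rw [← modelDeriv_comp_apply (contMDiff_smul_quotient_left hsub a⁻¹)
    (contMDiff_smul_quotient_left hsub a)]
  simp only [inv_smul_smul]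
  exact modelDeriv_id_apply x v

theorem modelDeriv_smul_inv_smul
    (hsub : Manifold.IsSubmersion 𝓘(ℝ, E) 𝓘(ℝ, E') ∞ (cosetProj H)) (a : G) {x y : G ⧸ H}
    (hy : y = a⁻¹ • x) (v : E') :
    modelDeriv E' E' (fun x : G ⧸ H => a • x) y (modelDeriv E' E' (fun x : G ⧸ H => a⁻¹ • x) x v) =
      v := by
  simpa using modelDeriv_inv_smul_smul hsub a⁻¹ hy v

theorem modelDeriv_proj_mul_left
    (hsub : Manifold.IsSubmersion 𝓘(ℝ, E) 𝓘(ℝ, E') ∞ (cosetProj H)) (a g : G) (u : E) :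
    modelDeriv E E' (cosetProj H) (a * g) (modelDeriv E E (fun x : G => a * x) g u) =
      modelDeriv E' E' (fun x : G ⧸ H => a • x) (cosetProj H g)
        (modelDeriv E E' (cosetProj H) g u) := by
  rw [← modelDeriv_comp_apply hsub.contMDiff (contMDiff_mul_left (a := a)),
    ← modelDeriv_comp_apply (contMDiff_smul_quotient_left hsub a) hsub.contMDiff]
  rfl

/-! ### Critical lifts of an invariant Finsler function -/

section CriticalLifts

variable {F₁ : TangentBundle 𝓘(ℝ, E) G → ℝ} {h : G → E' → E}

/-- The critical lifts of a left invariant Finsler function commute with left translations. -/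
theorem criticalLift_mul_left
    (hsub : Manifold.IsSubmersion 𝓘(ℝ, E) 𝓘(ℝ, E') ∞ (cosetProj H)) (hF₁ : IsFinslerFunction F₁)
    (hleft : IsLeftInvariant F₁)
    (hh : ∀ g, IsCriticalLift (fibreFunction F₁ g) (modelDeriv E E' (cosetProj H) g).toLinearMap
      (h g)) (a g : G) (v : E') :
    h (a * g) (modelDeriv E' E' (fun x : G ⧸ H => a • x) (cosetProj H g) v) =
      modelDeriv E E (fun x : G => a * x) g (h g v) :=
  IsCriticalLift.map_apply (hF₁.isMinkowskiNorm g) (hh g) (hF₁.isMinkowskiNorm (a * g))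
    (hh (a * g)) (surjective_modelDeriv_mul_left a g)
    (Function.LeftInverse.injective (modelDeriv_inv_smul_smul hsub a rfl))
    (fibreFunction_mul_left hleft a g) (modelDeriv_proj_mul_left hsub a g) v

/-- The critical lifts of a Finsler function invariant under right translations by `H` commute with
these translations. -/
theorem criticalLift_mul_right
    (hsub : Manifold.IsSubmersion 𝓘(ℝ, E) 𝓘(ℝ, E') ∞ (cosetProj H)) (hF₁ : IsFinslerFunction F₁)
    (hright : IsRightInvariantUnder H F₁)
    (hh : ∀ g, IsCriticalLift (fibreFunction F₁ g) (modelDeriv E E' (cosetProj H) g).toLinearMap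
      (h g)) {a : G} (ha : a ∈ H) (g : G) (v : E') :
    h (g * a) v = modelDeriv E E (fun x : G => x * a) g (h g v) :=
  IsCriticalLift.map_apply (hF₁.isMinkowskiNorm g) (hh g) (hF₁.isMinkowskiNorm (g * a))
    (hh (g * a)) (B := id) (surjective_modelDeriv_mul_right a g) Function.injective_id
    (fibreFunction_mul_right hright ha g) (modelDeriv_proj_mul_right hsub ha g) v

/-- The critical lift at `g` is that at `e`, transported by the left translation by `g`. -/
theorem criticalLift_eq_mul_left
    (hsub : Manifold.IsSubmersion 𝓘(ℝ, E) 𝓘(ℝ, E') ∞ (cosetProj H)) (hF₁ : IsFinslerFunction F₁)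
    (hleft : IsLeftInvariant F₁)
    (hh : ∀ g, IsCriticalLift (fibreFunction F₁ g) (modelDeriv E E' (cosetProj H) g).toLinearMap
      (h g)) (g : G) (v : E') :
    h g v = modelDeriv E E (fun x : G => g * x) 1
      (h 1 (modelDeriv E' E' (fun x : G ⧸ H => g⁻¹ • x) (cosetProj H g) v)) := by
  have hg : cosetProj H 1 = g⁻¹ • cosetProj H g := (inv_smul_eq_cosetProj_one rfl).symm
  rw [← criticalLift_mul_left hsub hF₁ hleft hh, modelDeriv_smul_inv_smul hsub g hg, mul_one]

/-- As `Ad a` is a left translation followed by a right translation by an element of `H`, the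
critical lift at `e` is `Ad(H)`-equivariant. -/
theorem criticalLift_adjointAction
    (hsub : Manifold.IsSubmersion 𝓘(ℝ, E) 𝓘(ℝ, E') ∞ (cosetProj H)) (hF₁ : IsFinslerFunction F₁)
    (hleft : IsLeftInvariant F₁) (hright : IsRightInvariantUnder H F₁)
    (hh : ∀ g, IsCriticalLift (fibreFunction F₁ g) (modelDeriv E E' (cosetProj H) g).toLinearMap
      (h g)) {a : G} (ha : a ∈ H) (u : E) :
    h 1 (modelDeriv E E' (cosetProj H) 1 (adjointAction E a u)) =
      adjointAction E a (h 1 (modelDeriv E E' (cosetProj H) 1 u)) := by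
  have h1 : a * 1 * a⁻¹ = 1 := by group
  have h2 := modelDeriv_proj_mul_right hsub (H.inv_mem ha) (a * 1)
    (modelDeriv E E (fun x : G => a * x) 1 u)
  have h3 := criticalLift_mul_right hsub hF₁ hright hh (H.inv_mem ha) (a * 1)
    (modelDeriv E' E' (fun x : G ⧸ H => a • x) (cosetProj H 1)
      (modelDeriv E E' (cosetProj H) 1 u))
  rw [h1] at h2 h3
  rw [adjointAction_apply, h2, modelDeriv_proj_mul_left hsub, h3,
    criticalLift_mul_left hsub hF₁ hleft hh, adjointAction_apply]

/-- The minimum of `F₁` along the fibres of the tangent map of `G → G/H`, computed at some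
representative of the coset. -/
def subducedFunction (F₁ : TangentBundle 𝓘(ℝ, E) G → ℝ) (h : G → E' → E) :
    TangentBundle 𝓘(ℝ, E') (G ⧸ H) → ℝ :=
  fun p => fibreFunction F₁ p.1.out (h p.1.out p.2)

/-- By right invariance under `H`, the subduced function may be computed at any representative. -/
theorem subducedFunction_mk
    (hsub : Manifold.IsSubmersion 𝓘(ℝ, E) 𝓘(ℝ, E') ∞ (cosetProj H)) (hF₁ : IsFinslerFunction F₁)
    (hright : IsRightInvariantUnder H F₁)
    (hh : ∀ g, IsCriticalLift (fibreFunction F₁ g) (modelDeriv E E' (cosetProj H) g).toLinearMap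
      (h g)) (g : G) (v : E') :
    subducedFunction F₁ h (TotalSpace.mk' E' (cosetProj H g) v) = fibreFunction F₁ g (h g v) := by
  obtain ⟨a, ha⟩ := QuotientGroup.mk_out_eq_mul H g
  change fibreFunction F₁ (g : G ⧸ H).out (h (g : G ⧸ H).out v) = _
  rw [ha, criticalLift_mul_right hsub hF₁ hright hh a.2, fibreFunction_mul_right hright a.2]

theorem fibreFunction_subducedFunction
    (hsub : Manifold.IsSubmersion 𝓘(ℝ, E) 𝓘(ℝ, E') ∞ (cosetProj H)) (hF₁ : IsFinslerFunction F₁)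
    (hright : IsRightInvariantUnder H F₁)
    (hh : ∀ g, IsCriticalLift (fibreFunction F₁ g) (modelDeriv E E' (cosetProj H) g).toLinearMap
      (h g)) (g : G) :
    fibreFunction (subducedFunction (H := H) F₁ h) (cosetProj H g) = fibreFunction F₁ g ∘ h g :=
  funext (subducedFunction_mk hsub hF₁ hright hh g)

theorem isGInvariant_subducedFunction
    (hsub : Manifold.IsSubmersion 𝓘(ℝ, E) 𝓘(ℝ, E') ∞ (cosetProj H)) (hF₁ : IsFinslerFunction F₁)
    (hleft : IsLeftInvariant F₁) (hright : IsRightInvariantUnder H F₁)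
    (hh : ∀ g, IsCriticalLift (fibreFunction F₁ g) (modelDeriv E E' (cosetProj H) g).toLinearMap
      (h g)) : IsGInvariant (subducedFunction (H := H) F₁ h) := by
  rintro a ⟨x, w⟩
  obtain ⟨g, rfl⟩ := cosetProj_surjective (H := H) x
  obtain ⟨v, rfl⟩ : ∃ v : E', v = w := ⟨w, rfl⟩
  refine (subducedFunction_mk hsub hF₁ hright hh (a * g)
    (modelDeriv E' E' (fun x : G ⧸ H => a • x) (cosetProj H g) v)).trans ?_
  rw [criticalLift_mul_left hsub hF₁ hleft hh, fibreFunction_mul_left hleft]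
  exact (subducedFunction_mk hsub hF₁ hright hh g v).symm

theorem isFinslerSubmersion_subducedFunction [FiniteDimensional ℝ E] [FiniteDimensional ℝ E']
    (hsub : Manifold.IsSubmersion 𝓘(ℝ, E) 𝓘(ℝ, E') ∞ (cosetProj H)) (hF₁ : IsFinslerFunction F₁)
    (hright : IsRightInvariantUnder H F₁)
    (hh : ∀ g, IsCriticalLift (fibreFunction F₁ g) (modelDeriv E E' (cosetProj H) g).toLinearMap
      (h g)) : IsFinslerSubmersion (cosetProj H) F₁ (subducedFunction (H := H) F₁ h) := by
  refine ⟨hsub.contMDiff, cosetProj_surjective, fun g => ?_⟩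
  have h1 := (hh g).isMinkowskiSubmersion (hF₁.isMinkowskiNorm g)
  rw [← fibreFunction_subducedFunction hsub hF₁ hright hh] at h1
  exact h1

variable [IsManifold 𝓘(ℝ, E') ∞ (G ⧸ H)]

/-- Near each tangent vector of `G/H`, the subduced function is the composition of the Minkowski
norm which it induces on `T_o(G/H)` with a smooth map, nonzero at nonzero vectors: translation to
`o` by a local section of the projection. -/
theorem exists_subducedFunction_eventuallyEq
    (hsub : Manifold.IsSubmersion 𝓘(ℝ, E) 𝓘(ℝ, E') ∞ (cosetProj H)) (hF₁ : IsFinslerFunction F₁)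
    (hleft : IsLeftInvariant F₁) (hright : IsRightInvariantUnder H F₁)
    (hh : ∀ g, IsCriticalLift (fibreFunction F₁ g) (modelDeriv E E' (cosetProj H) g).toLinearMap
      (h g)) (p : TangentBundle 𝓘(ℝ, E') (G ⧸ H)) :
    ∃ X : TangentBundle 𝓘(ℝ, E') (G ⧸ H) → E',
      ContMDiffAt 𝓘(ℝ, E').tangent 𝓘(ℝ, E') ∞ X p ∧ (p.2 ≠ 0 → X p ≠ 0) ∧
      subducedFunction (H := H) F₁ h =ᶠ[𝓝 p] fun p => (fibreFunction F₁ 1 ∘ h 1) (X p) := by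
  obtain ⟨x, v⟩ := p
  obtain ⟨g, rfl⟩ := cosetProj_surjective (H := H) x
  obtain ⟨σ, hσ, -, hqσ⟩ := exists_local_section (hsub.isSubmersionAt g)
  let p : TangentBundle 𝓘(ℝ, E') (G ⧸ H) := ⟨cosetProj H g, v⟩
  have hev : ∀ᶠ p' in 𝓝 p, cosetProj H (σ p'.1) = p'.1 :=
    (contMDiffAt_proj (TangentSpace 𝓘(ℝ, E')) (n := ∞) (IB := 𝓘(ℝ, E'))
      (p := p)).continuousAt.eventually hqσ
  have hσ' : ContMDiffAt 𝓘(ℝ, E').tangent 𝓘(ℝ, E) ∞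
      (fun p' : TangentBundle 𝓘(ℝ, E') (G ⧸ H) => (σ p'.1)⁻¹) p :=
    (ContMDiffAt.comp p hσ (contMDiffAt_proj (TangentSpace 𝓘(ℝ, E')))).inv
  have hT : ContMDiffAt 𝓘(ℝ, E').tangent 𝓘(ℝ, E').tangent ∞
      (fun p' : TangentBundle 𝓘(ℝ, E') (G ⧸ H) =>
        tangentMap 𝓘(ℝ, E') 𝓘(ℝ, E') (fun x : G ⧸ H => (σ p'.1)⁻¹ • x) p') p :=
    (contMDiff_tangentMap_family (α := fun (a : G) (x : G ⧸ H) => a • x)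
      (contMDiff_smul_quotient hsub)).contMDiffAt.comp p (hσ'.prodMk contMDiffAt_id)
  refine ⟨_, contMDiffAt_snd_of_eventually_proj_eq (cosetProj H 1) hT ?_, fun hv hX => hv ?_, ?_⟩
  · filter_upwards [hev] with p' hp'
    exact inv_smul_eq_cosetProj_one hp'
  · have h1 := modelDeriv_smul_inv_smul hsub (σ (cosetProj H g)) (x := cosetProj H g) rfl v
    rw [← h1]
    have h2 : modelDeriv E' E' (fun x : G ⧸ H => (σ (cosetProj H g))⁻¹ • x) (cosetProj H g) v = 0 :=
      hX
    rw [h2, map_zero]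
    rfl
  · filter_upwards [hev] with p' hp'
    obtain ⟨y, w'⟩ := p'
    obtain ⟨w, rfl⟩ : ∃ w : E', w = w' := ⟨w', rfl⟩
    change cosetProj H (σ y) = y at hp'
    have h1 := subducedFunction_mk hsub hF₁ hright hh (σ y) w
    rw [criticalLift_eq_mul_left hsub hF₁ hleft hh] at h1
    have h2 := fibreFunction_mul_left hleft (σ y) 1
      (h 1 (modelDeriv E' E' (fun x : G ⧸ H => (σ y)⁻¹ • x) (cosetProj H (σ y)) w))
    rw [mul_one] at h2
    rw [h2, hp'] at h1
    exact h1

variable [FiniteDimensional ℝ E] [FiniteDimensional ℝ E']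

theorem isFinslerFunction_subducedFunction
    (hsub : Manifold.IsSubmersion 𝓘(ℝ, E) 𝓘(ℝ, E') ∞ (cosetProj H)) (hF₁ : IsFinslerFunction F₁)
    (hleft : IsLeftInvariant F₁) (hright : IsRightInvariantUnder H F₁)
    (hh : ∀ g, IsCriticalLift (fibreFunction F₁ g) (modelDeriv E E' (cosetProj H) g).toLinearMap
      (h g)) : IsFinslerFunction (subducedFunction (H := H) F₁ h) := by
  have hmin : ∀ g, IsMinkowskiNorm (fibreFunction F₁ g ∘ h g) := fun g =>
    (hh g).isMinkowskiNorm_comp (hF₁.isMinkowskiNorm g)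
  refine ⟨fun p => hF₁.nonneg _, continuous_iff_continuousAt.2 fun p => ?_,
    fun p hp => ContMDiffAt.contMDiffWithinAt ?_, fun c x v hc => ?_, fun x => ?_⟩
  · obtain ⟨X, hX, -, heq⟩ := exists_subducedFunction_eventuallyEq hsub hF₁ hleft hright hh p
    exact ((hmin 1).continuous.continuousAt.comp hX.continuousAt).congr heq.symm
  · obtain ⟨X, hX, hX0, heq⟩ := exists_subducedFunction_eventuallyEq hsub hF₁ hleft hright hh p
    exact (((hmin 1).contDiffAt (hX0 hp)).contMDiffAt.comp p hX).congr_of_eventuallyEq heq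
  · obtain ⟨g, rfl⟩ := cosetProj_surjective (H := H) x
    have h1 := (hmin g).homogeneous c v hc
    rw [← fibreFunction_subducedFunction hsub hF₁ hright hh] at h1
    exact h1
  · obtain ⟨g, rfl⟩ := cosetProj_surjective (H := H) x
    have h1 := (hmin g).strongly_convex
    rw [← fibreFunction_subducedFunction hsub hF₁ hright hh] at h1
    exact h1

/-- The critical lifts depend smoothly on the point as well: they are the lift at `e`, conjugated by
the smooth families of the tangent maps of the left translations and of the action on `G/H`. -/
theorem contMDiffOn_splittingMap_criticalLift
    (hsub : Manifold.IsSubmersion 𝓘(ℝ, E) 𝓘(ℝ, E') ∞ (cosetProj H)) (hF₁ : IsFinslerFunction F₁)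
    (hleft : IsLeftInvariant F₁)
    (hh : ∀ g, IsCriticalLift (fibreFunction F₁ g) (modelDeriv E E' (cosetProj H) g).toLinearMap
      (h g)) :
    ContMDiffOn (𝓘(ℝ, E).prod 𝓘(ℝ, E')) 𝓘(ℝ, E).tangent ∞ (splittingMap (cosetProj H) h)
      {p | (show TangentSpace 𝓘(ℝ, E') (cosetProj H p.1) from p.2) ≠ 0} := by
  intro p hp
  refine ContMDiffAt.contMDiffWithinAt ?_
  let B := TotalSpace E' (cosetProj H *ᵖ (TangentSpace 𝓘(ℝ, E') : G ⧸ H → Type _))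
  have hbase : ContMDiff (𝓘(ℝ, E).prod 𝓘(ℝ, E')) 𝓘(ℝ, E) ∞ (fun p : B => p.1) :=
    contMDiff_proj _
  have hT : ContMDiffAt (𝓘(ℝ, E).prod 𝓘(ℝ, E')) 𝓘(ℝ, E').tangent ∞
      (fun p : B => tangentMap 𝓘(ℝ, E') 𝓘(ℝ, E') (fun x : G ⧸ H => p.1⁻¹ • x)
        (TotalSpace.mk' E' (cosetProj H p.1) p.2)) p :=
    ((contMDiff_tangentMap_family (α := fun (a : G) (x : G ⧸ H) => a • x)
      (contMDiff_smul_quotient hsub)).comp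
      (hbase.inv.prodMk (contMDiff_pullback_lift (cosetProj H) hsub.contMDiff))).contMDiffAt
  have hX := contMDiffAt_snd_of_eventually_proj_eq (cosetProj H 1) hT
    (Eventually.of_forall fun p => inv_smul_eq_cosetProj_one rfl)
  have hX0 : modelDeriv E' E' (fun x : G ⧸ H => p.1⁻¹ • x) (cosetProj H p.1) p.2 ≠ 0 := by
    intro h0
    refine hp ?_
    have h1 := modelDeriv_smul_inv_smul hsub p.1 (x := cosetProj H p.1) rfl p.2
    rw [h0, map_zero] at h1
    exact h1.symm
  have hk := ((hh 1).contDiffAt (hF₁.isMinkowskiNorm 1) hX0).contMDiffAt.comp p hX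
  have hS := (contMDiff_tangentMap_family (α := fun (a : G) (x : G) => a * x)
    (contMDiff_mul 𝓘(ℝ, E) ∞)).contMDiffAt.comp p (hbase.contMDiffAt.prodMk
      ((contMDiffAt_tangentBundle_mk_iff (1 : G)).2 hk))
  refine hS.congr_of_eventuallyEq (Eventually.of_forall fun p => ?_)
  exact (congrArg (TotalSpace.mk' E p.1) (criticalLift_eq_mul_left hsub hF₁ hleft hh p.1 p.2)).trans
    (tangentBundle_mk_congr (mul_one p.1).symm _)

end CriticalLifts

end HomogeneousSpace

end

theorem mainTheorem6
    {E : Type*} [NormedAddCommGroup E] [NormedSpace ℝ E] [FiniteDimensional ℝ E]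
    {E' : Type*} [NormedAddCommGroup E'] [NormedSpace ℝ E'] [FiniteDimensional ℝ E']
    -- `G` is a connected Lie group and `H` a closed subgroup
    {G : Type*} [TopologicalSpace G] [ChartedSpace E G] [Group G] [LieGroup 𝓘(ℝ, E) ∞ G]
    [ConnectedSpace G] (H : Subgroup G) (hH : IsClosed (H : Set G))
    -- `G/H` carries its smooth structure, the one for which the projection is a submersion
    [ChartedSpace E' (G ⧸ H)] [IsManifold 𝓘(ℝ, E') ∞ (G ⧸ H)]
    (hsub : Manifold.IsSubmersion 𝓘(ℝ, E) 𝓘(ℝ, E') ∞ (cosetProj H))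
    -- `G/H` is reductive: `𝔤 = 𝔥 ⊕ 𝔪` with `𝔪` invariant under `Ad(H)`
    (𝔪 : Submodule ℝ E) (h𝔪 : IsReductiveComplement H 𝔪)
    (F₁ : TangentBundle 𝓘(ℝ, E) G → ℝ) (hF₁ : IsFinslerFunction F₁)
    (hleft : IsLeftInvariant F₁) (hright : IsRightInvariantUnder H F₁) :
    -- the isomorphism `β : 𝔪 → T_o(G/H)`, the restriction to `𝔪` of the tangent map at `e`
    ∃ β : 𝔪 ≃ₗ[ℝ] TangentSpace 𝓘(ℝ, E') (cosetProj H 1),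
      (∀ ζ : 𝔪, β ζ = mfderiv 𝓘(ℝ, E) 𝓘(ℝ, E') (cosetProj H) 1
        (show TangentSpace 𝓘(ℝ, E) (1 : G) from (ζ : E))) ∧
    -- (i) the lift `hbar : 𝔪 → 𝔤` for the projection `𝔤 → 𝔪`, induced by `F₁` at `e`
    ∃ hbar : 𝔪 → E,
      IsHomogeneousNonlinearLift (𝔪.projectionOnto _ h𝔪.isCompl) hbar ∧
      IsLiftInducedBy (fibreFunction F₁ 1) (𝔪.projectionOnto _ h𝔪.isCompl) hbar ∧
      (∀ (a : G) (ha : a ∈ H) (ζ : 𝔪),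
        hbar ⟨adjointAction E a ζ, h𝔪.adjoint_mem a ha ζ ζ.2⟩ = adjointAction E a (hbar ζ)) ∧
    -- (ii) the subduced Finsler function on `G/H`
      (∃ F₂ : TangentBundle 𝓘(ℝ, E') (G ⧸ H) → ℝ,
        IsFinslerFunction F₂ ∧ IsGInvariant F₂ ∧ IsFinslerSubmersion (cosetProj H) F₁ F₂ ∧
        ∀ F : TangentBundle 𝓘(ℝ, E') (G ⧸ H) → ℝ,
          IsFinslerFunction F → IsFinslerSubmersion (cosetProj H) F₁ F → F = F₂) ∧
    -- (iii) the splitting induced by `F₁` and its relation to `hbar`; the vector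
    -- `T τ_{g⁻¹} v` is based at `g⁻¹ • gH = o`
      (∃ h : ∀ g : G, TangentSpace 𝓘(ℝ, E') (cosetProj H g) → TangentSpace 𝓘(ℝ, E) g,
        IsHomogeneousNonlinearSplitting (cosetProj H) h ∧
        IsSplittingInducedBy F₁ (cosetProj H) h ∧
        (∀ h' : ∀ g : G, TangentSpace 𝓘(ℝ, E') (cosetProj H g) → TangentSpace 𝓘(ℝ, E) g,
          IsSplittingInducedBy F₁ (cosetProj H) h' → h' = h) ∧
        ∀ (g : G) (v : TangentSpace 𝓘(ℝ, E') (cosetProj H g)),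
          TotalSpace.mk' E g (h g v) =
            tangentMap 𝓘(ℝ, E) 𝓘(ℝ, E) (fun x : G => g * x)
              (TotalSpace.mk' E (1 : G) (show TangentSpace 𝓘(ℝ, E) (1 : G) from
                hbar (β.symm (show TangentSpace 𝓘(ℝ, E') (cosetProj H 1) from
                  mfderiv 𝓘(ℝ, E') 𝓘(ℝ, E') (fun x : G ⧸ H => g⁻¹ • x) (cosetProj H g) v))))) := by
  obtain ⟨β, hβ, hβp⟩ := exists_linearEquiv_of_isCompl hsub h𝔪.isCompl
  -- The critical lifts of `F₁` at all points of `G`.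
  have hex : ∀ g : G, ∃ k : E' → E, IsCriticalLift (fibreFunction F₁ g)
      (modelDeriv E E' (cosetProj H) g).toLinearMap k := fun g =>
    (hF₁.isMinkowskiNorm g).exists_isCriticalLift
      (surjective_mfderiv_of_isSubmersionAt (hsub.isSubmersionAt g))
  choose h hh using hex
  have hbar : IsCriticalLift (fibreFunction F₁ 1) (𝔪.projectionOnto _ h𝔪.isCompl)
      (fun ζ => h 1 (β ζ)) := by
    refine fun ζ => ⟨β.injective ?_, fun w hw => (hh 1 (β ζ)).2 w ?_⟩
    · rw [hβp]
      exact (hh 1 (β ζ)).1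
    · refine (hβp w).symm.trans ?_
      rw [hw, map_zero]
  refine ⟨β, hβ, fun ζ => h 1 (β ζ), hbar.isHomogeneousNonlinearLift (hF₁.isMinkowskiNorm 1),
    hbar.isLiftInducedBy (hF₁.isMinkowskiNorm 1), fun a ha ζ => ?_,
    ⟨subducedFunction F₁ h, isFinslerFunction_subducedFunction hsub hF₁ hleft hright hh,
      isGInvariant_subducedFunction hsub hF₁ hleft hright hh,
      isFinslerSubmersion_subducedFunction hsub hF₁ hright hh, fun F hF hq => hq.unique hF
        (isFinslerFunction_subducedFunction hsub hF₁ hleft hright hh)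
        (isFinslerSubmersion_subducedFunction hsub hF₁ hright hh)⟩,
    ⟨h, ⟨fun g v => (hh g v).1, contMDiffOn_splittingMap_criticalLift hsub hF₁ hleft hh,
      fun c g v hc => (hh g).homogeneous (hF₁.isMinkowskiNorm g) c v hc⟩, fun g v => hh g v,
      fun h' hh' => funext fun g => (hh g).unique (hF₁.isMinkowskiNorm g) (hh' g),
      fun g v => ?_⟩⟩
  · dsimp only
    rw [hβ, hβ]
    exact criticalLift_adjointAction hsub hF₁ hleft hright hh ha ζ
  · refine (congrArg (TotalSpace.mk' E g)
      (criticalLift_eq_mul_left hsub hF₁ hleft hh g v)).trans ?_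
    refine (tangentBundle_mk_congr (mul_one g).symm _).trans ?_
    exact congrArg (fun w => (TotalSpace.mk' E (g * 1) (modelDeriv E E (fun x : G => g * x) 1
      (h 1 w)) : TangentBundle 𝓘(ℝ, E) G)) (β.apply_symm_apply _).symm
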